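/- Let $k$ be a field and $B$ a ring-indecomposable (in particular non-zero) finite-dimensional $k$-algebra, and let $\mathrm{mod}\,B$ be the category of finite-dimensional right $B$-modules. Assume that $B$ is symmetric, i.e. $B\cong \mathrm{Hom}_k(B,k)$ as $B$-bimodules, and that $B$ is a Nakayama algebra, i.e. every indecomposable projective and every indecomposable injective module in $\mathrm{mod}\,B$ is uniserial (its submodules form a chain). Let $n$ be the number of isomorphism classes of simple right $B$-modules, suppose that $B$ has Loewy length $an+1$ for an integer $a\ge 1$ (i.e. $an+1$ is the least integer $l$ with $\mathrm{rad}(B)^l=0$), and let $d\ge 2$ be an integer. A $d$-cluster-tilting subcategory of $\mathrm{mod}\,B$ is a functorially finite full subcategory $\mathcal U$ such that $$\mathcal U=\{X\in\mathrm{mod}\,B \mid \mathrm{Ext}_B^i(X,U)=0\ \ \forall\, U\in\mathcal U,\ 1\le i\le d-1\}=\{X\in\mathrm{mod}\,B \mid \mathrm{Ext}_B^i(U,X)=0\ \ \forall\, U\in\mathcal U,\ 1\le i\le d-1\}.$$ The algebra $B$ is $d$-representation-finite if there is a module $M$ in $\mathrm{mod}\,B$ such that $\mathrm{add}\,M$,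 the full subcategory of all direct summands of finite direct sums of copies of $M$, is a $d$-cluster-tilting subcategory of $\mathrm{mod}\,B$. **Theorem.** $B$ is $d$-representation-finite if and only if $$(a,n,d)\in\{(1,t,2t-1)\mid t\ge 2\}\cup\{(1,3,2),(1,6,2),(2,3,2)\}.$$ -/

import Mathlib

open CategoryTheory

universe u v

namespace NakayamaCT

/-! Right `B`-modules are modules over `Bᵐᵒᵖ`. If `B` is finite-dimensional over a field, then a
right `B`-module is finite-dimensional if and only if it is finitely generated. -/

/-- A module is uniserial if its submodules form a chain. -/
def IsUniserial (R : Type u) [Ring R] (M : Type u) [AddCommGroup M] [Module R M] : Prop :=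
  ∀ N N' : Submodule R M, N ≤ N' ∨ N' ≤ N

/-- A module is indecomposable if it is non-zero and is not the internal direct sum of two non-zero
submodules. -/
def IsIndecomposableModule (R : Type u) [Ring R] (M : Type u) [AddCommGroup M] [Module R M] :
    Prop :=
  Nontrivial M ∧ ∀ N N' : Submodule R M, IsCompl N N' → N = ⊥ ∨ N' = ⊥

/-- Nakayama algebras: all indecomposable projective and all indecomposable injective
finitely generated right modules are uniserial. -/
def IsNakayama (B : Type u) [Ring B] : Prop :=
  ∀ (M : Type u) [AddCommGroup M] [Module Bᵐᵒᵖ M], Module.Finite Bᵐᵒᵖ M →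
    IsIndecomposableModule Bᵐᵒᵖ M → (Module.Projective Bᵐᵒᵖ M ∨ Module.Injective Bᵐᵒᵖ M) →
    IsUniserial Bᵐᵒᵖ M

/-- Symmetric algebras: `B` is isomorphic to its `k`-dual `D B` as a `B`-bimodule, where the
bimodule structure on `D B` is `(a f b) (y) = f (b y a)`. -/
def IsSymmetricAlgebra (k : Type v) (B : Type u) [Field k] [Ring B] [Algebra k B] : Prop :=
  ∃ φ : B ≃ₗ[k] Module.Dual k B, ∀ a x b y : B, φ (a * x * b) y = φ x (b * y * a)

/-- Ring-indecomposable (non-zero) rings: `0` and `1` are the only central idempotents. -/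
def IsRingIndecomposable (B : Type u) [Ring B] : Prop :=
  Nontrivial B ∧ ∀ e : B, IsIdempotentElem e → e ∈ Set.center B → e = 0 ∨ e = 1

/-- There are exactly `n` isomorphism classes of simple right `B`-modules. -/
def HasNumSimples (B : Type u) [Ring B] (n : ℕ) : Prop :=
  ∃ S : Fin n → ModuleCat.{u} Bᵐᵒᵖ,
    (∀ i, IsSimpleModule Bᵐᵒᵖ (S i)) ∧
    (∀ i j, Nonempty (S i ≃ₗ[Bᵐᵒᵖ] S j) → i = j) ∧
    ∀ T : ModuleCat.{u} Bᵐᵒᵖ, IsSimpleModule Bᵐᵒᵖ T → ∃ i, Nonempty (T ≃ₗ[Bᵐᵒᵖ] S i)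

/-- `B` has Loewy length `l`: `l` is the least natural number such that the `l`-th power of the
Jacobson radical of `B` is zero. -/
def HasLoewyLength (B : Type u) [Ring B] (l : ℕ) : Prop :=
  IsLeast {m : ℕ | (Ring.jacobson B) ^ m = ⊥} l

/-- The additive closure `add M`: direct summands of finite direct sums of copies of `M`. -/
def addClosure (R : Type u) [Ring R] (M : ModuleCat.{u} R) : ObjectProperty (ModuleCat.{u} R) :=
  fun X => ∃ (r : ℕ) (s : X →ₗ[R] (Fin r → M)) (p : (Fin r → M) →ₗ[R] X), p ∘ₗ s = LinearMap.id

/-- `d`-cluster-tilting subcategories `U` of the category of finitely generated `R`-modules: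
`U` is functorially finite (all finitely generated modules have right and left
`U`-approximations), and `U` consists exactly of the finitely generated `X` with
`Ext^i(X, U) = 0` for `1 ≤ i ≤ d - 1`, and exactly of those with `Ext^i(U, X) = 0` for
`1 ≤ i ≤ d - 1`. -/
structure IsClusterTilting (R : Type u) [Ring R] (d : ℕ)
    (U : ObjectProperty (ModuleCat.{u} R)) : Prop where
  finite : ∀ X, U X → Module.Finite R X
  contravariantlyFinite : ∀ X : ModuleCat.{u} R, Module.Finite R X →
    ∃ (V : ModuleCat.{u} R) (f : V ⟶ X), U V ∧
      ∀ (W : ModuleCat.{u} R) (g : W ⟶ X), U W → ∃ h : W ⟶ V, h ≫ f = g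
  covariantlyFinite : ∀ X : ModuleCat.{u} R, Module.Finite R X →
    ∃ (V : ModuleCat.{u} R) (f : X ⟶ V), U V ∧
      ∀ (W : ModuleCat.{u} R) (g : X ⟶ W), U W → ∃ h : V ⟶ W, f ≫ h = g
  mem_iff_ext_left : ∀ X : ModuleCat.{u} R, Module.Finite R X →
    (U X ↔ ∀ Y : ModuleCat.{u} R, U Y → ∀ i : ℕ, 1 ≤ i → i < d →
      Subsingleton (Abelian.Ext X Y i))
  mem_iff_ext_right : ∀ X : ModuleCat.{u} R, Module.Finite R X →
    (U X ↔ ∀ Y : ModuleCat.{u} R, U Y → ∀ i : ℕ, 1 ≤ i → i < d →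
      Subsingleton (Abelian.Ext Y X i))

/-- `B` is `d`-representation-finite: there is a finitely generated right `B`-module `M` such that
`add M` is a `d`-cluster-tilting subcategory of the category of finitely generated right
`B`-modules. -/
def IsRepresentationFinite (d : ℕ) (B : Type u) [Ring B] : Prop :=
  ∃ M : ModuleCat.{u} Bᵐᵒᵖ, Module.Finite Bᵐᵒᵖ M ∧
    IsClusterTilting Bᵐᵒᵖ d (addClosure Bᵐᵒᵖ M)

end NakayamaCT

/-! The symmetrising form makes the algebra self-injective and gives every indecomposable projective
isomorphic top and socle. Together with uniserial projectives this forces every indecomposable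
module to be a quotient of an indecomposable projective (`exists_cover_of_indecomposable`), and
ring-indecomposability arranges the projectives in one oriented `n`-cycle with common length `a * n
+ 1` (`exists_isNakayamaSystem`). A non-projective indecomposable is thus a pair (top `i`, length
`l`) with `1 ≤ l ≤ a * n`. Its syzygy is `(i + l, a * n + 1 - l)`, so two syzygies shift `i` by one.
By `subsingleton_ext_iff`, non-vanishing of Ext between such modules is the arithmetic condition
`StHom`, and the theorem becomes one about subsets `U` of `ZMod n × ℕ`.

Write Ω for the syzygy. It is a Serre functor on the stable category, so `U` is stable under Ω^(d+1)
(`serre_mem`), while `x` and Ω^e `x` can both lie in `U` only if `d + 1 ∣ e` (`dvd_of_mem`). Since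
Ω^(2n) fixes all objects, `d + 1 ∣ 2 * n`. Testing a member of `U` against its own
Ω^(d+1)-translates restricts the lengths: only `1` and `a * n` occur for `d ≥ 3` (`quasiSimple`),
and also `2` and `a * n - 1` for `d = 2` (`length_of_two`); the latter two are excluded once `a * n
≥ 9` (`two_not_mem`). When only syzygies of simples occur, `U` lies in a single Ω-orbit, and no
object of it obstructs a suitable module of length `l` with `2 * l` congruent to `1` or `2` modulo
`d + 1`. That module would have to be in `U`, so `l` is `1` or `a * n` (`mem_of_quasiSimple`). For
`d ≥ 3` this leaves `a = 1`, `d = 2 * n - 1`; for `d = 2` it leaves `3 ∣ n` and `a * n < 9`.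

Conversely, one simple module works in the infinite family, and in the three sporadic cases the
Ω^3-closure of `(0, 1)` and `(0, 2)` works, by finite verification. Adding the regular module gives
the cluster tilting module (`exists_isClusterTilting`). -/

namespace NakayamaCT

/-! ### Combinatorics of the stable category

A pair `(i, l)` with `i : ZMod n` and `1 ≤ l ≤ a * n` encodes the uniserial module of length `l`
whose top is the `i`-th simple module. -/

/-- The syzygy on pairs (top, length). -/
def syz (a : ℕ) {n : ℕ} (x : ZMod n × ℕ) : ZMod n × ℕ := (x.1 + x.2, a * n + 1 - x.2)

/-- Non-vanishing of the stable homomorphism space, on pairs (top, length). -/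
def StHom (a : ℕ) {n : ℕ} (x y : ZMod n × ℕ) : Prop :=
  -- Here `c` is the length of the image. A map factors through the injective hull of its source
  -- exactly when an image of length `c + (a * n + 1 - x.2)` fits into the target; the strict
  -- inequality excludes this. The bound `c < x.2 + 1` is in the form that the decidability of
  -- bounded existentials expects.
  ∃ c : ℕ, c < x.2 + 1 ∧ 1 ≤ c ∧ c ≤ y.2 ∧ x.2 + y.2 < c + (a * n + 1) ∧
    x.1 + c = y.1 + y.2

instance (a : ℕ) {n : ℕ} (x y : ZMod n × ℕ) : Decidable (StHom a x y) :=
  inferInstanceAs (Decidable (∃ c : ℕ, c < x.2 + 1 ∧ _))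

/-- The combinatorial version of `d`-cluster-tilting subcategories. -/
structure IsCombCT (a n d : ℕ) (U : Set (ZMod n × ℕ)) : Prop where
  valid : ∀ x ∈ U, 1 ≤ x.2 ∧ x.2 ≤ a * n
  mem_left : ∀ x : ZMod n × ℕ, 1 ≤ x.2 → x.2 ≤ a * n →
    (x ∈ U ↔ ∀ y ∈ U, ∀ r, 1 ≤ r → r < d → ¬ StHom a ((syz a)^[r] x) y)
  mem_right : ∀ x : ZMod n × ℕ, 1 ≤ x.2 → x.2 ≤ a * n →
    (x ∈ U ↔ ∀ y ∈ U, ∀ r, 1 ≤ r → r < d → ¬ StHom a ((syz a)^[r] y) x)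

section
variable {a n : ℕ} {x y : ZMod n × ℕ}

/-- The two lengths add up to `a * n + 1`, which is `1` modulo `n`; this is the effect of the Loewy
length on the cycle. -/
lemma syz_syz (hx : x.2 ≤ a * n) : syz a (syz a x) = (x.1 + 1, x.2) := by
  have h : a * n + 1 - (a * n + 1 - x.2) = x.2 := by omega
  simp only [syz, h, Prod.mk.injEq, and_true, add_assoc]
  rw [← Nat.cast_add, show x.2 + (a * n + 1 - x.2) = a * n + 1 by omega]
  simp

lemma syz_valid (h1 : 1 ≤ x.2) (h2 : x.2 ≤ a * n) :
    1 ≤ (syz a x).2 ∧ (syz a x).2 ≤ a * n := by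
  simp only [syz]; omega

lemma syz_iterate_valid (r : ℕ) (h1 : 1 ≤ x.2) (h2 : x.2 ≤ a * n) :
    1 ≤ ((syz a)^[r] x).2 ∧ ((syz a)^[r] x).2 ≤ a * n := by
  induction r with
  | zero => exact ⟨h1, h2⟩
  | succ r ih => rw [Function.iterate_succ_apply']; exact syz_valid ih.1 ih.2

lemma syz_iterate_even (hx : x.2 ≤ a * n) (k : ℕ) : (syz a)^[2 * k] x = (x.1 + k, x.2) := by
  induction k with
  | zero => simp
  | succ k ih =>
    rw [show 2 * (k + 1) = 2 * k + 1 + 1 by ring, Function.iterate_succ_apply',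
      Function.iterate_succ_apply', ih, syz_syz (by simpa using hx)]
    simp [add_assoc]

lemma syz_iterate_odd (hx : x.2 ≤ a * n) (k : ℕ) :
    (syz a)^[2 * k + 1] x = (x.1 + k + x.2, a * n + 1 - x.2) := by
  rw [Function.iterate_succ_apply', syz_iterate_even hx]; rfl

lemma syz_iterate_period (hx : x.2 ≤ a * n) : (syz a)^[2 * n] x = x := by
  rw [syz_iterate_even hx]; simp

lemma syz_iterate_period_mul (hx : x.2 ≤ a * n) (m : ℕ) : (syz a)^[2 * n * m] x = x := by
  rw [mul_assoc, syz_iterate_even hx]; simp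

/-- The stable category of a symmetric algebra is `(-1)`-Calabi-Yau. -/
lemma stHom_dual (hx : x.2 ≤ a * n) : StHom a x y ↔ StHom a y (syz a x) := by
  have e : ∀ c : ℕ, c ≤ y.2 + 1 → ((x.1 + c = y.1 + y.2) ↔
      (y.1 + ((y.2 + 1 - c : ℕ) : ZMod n) = x.1 + x.2 + ((a * n + 1 - x.2 : ℕ) : ZMod n))) := by
    intro c hc
    rw [add_assoc x.1, ← Nat.cast_add, show x.2 + (a * n + 1 - x.2) = a * n + 1 by omega,
      Nat.cast_sub hc]
    push_cast
    simp only [CharP.cast_eq_zero, mul_zero, zero_add]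
    constructor <;> intro h
    · linear_combination -h
    · linear_combination -h
  constructor
  · rintro ⟨c, h1, h2, h3, h4, h5⟩
    -- The involution `c ↦ y.2 + 1 - c` exchanges image lengths on the two sides: each inequality
    -- for one becomes an inequality for the other.
    exact ⟨y.2 + 1 - c, by omega, by omega, by simp only [syz]; omega, by simp only [syz]; omega,
      (e c (by omega)).1 h5⟩
  · rintro ⟨c, h1, h2, h3, h4, h5⟩
    simp only [syz] at h3 h4 h5
    refine ⟨y.2 + 1 - c, by omega, by omega, by omega, by omega, (e _ (by omega)).2 ?_⟩
    rwa [show y.2 + 1 - (y.2 + 1 - c) = c by omega]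

/-- Applying the duality twice suffices: both sides are equivalent to `StHom a y (syz a x)`. -/
lemma stHom_syz (hx : x.2 ≤ a * n) (hy : y.2 ≤ a * n) :
    StHom a (syz a x) (syz a y) ↔ StHom a x y := by
  rw [stHom_dual hx, stHom_dual hy]

lemma stHom_iterate (r : ℕ) (hx1 : 1 ≤ x.2) (hx : x.2 ≤ a * n) (hy1 : 1 ≤ y.2) (hy : y.2 ≤ a * n) :
    StHom a ((syz a)^[r] x) ((syz a)^[r] y) ↔ StHom a x y := by
  induction r with
  | zero => rfl
  | succ r ih =>
    rw [Function.iterate_succ_apply', Function.iterate_succ_apply',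
      stHom_syz (syz_iterate_valid r hx1 hx).2 (syz_iterate_valid r hy1 hy).2, ih]

lemma stHom_self (h1 : 1 ≤ x.2) (h2 : x.2 ≤ a * n) : StHom a x x :=
  ⟨x.2, by omega, h1, le_rfl, by omega, rfl⟩

/-- A non-zero map to a simple module has image of length one, so only the top of the source
matters. This turns vanishing against syzygies of simples into congruences. -/
lemma stHom_simple {i j : ZMod n} {l : ℕ} (h1 : 1 ≤ l) (h2 : l ≤ a * n) :
    StHom a (i, l) (j, 1) ↔ i = j := by
  constructor
  · rintro ⟨c, h1, h2, h3, h4, h5⟩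
    obtain rfl : c = 1 := by simp only at h3; omega
    simpa using h5
  · rintro rfl
    exact ⟨1, by simp only; omega, le_rfl, le_rfl, by simp only; omega, rfl⟩

/-- Serre duality for the extension groups. -/
lemma stHom_serre {d r : ℕ} (hr : r ≤ d) (hx1 : 1 ≤ x.2) (hx : x.2 ≤ a * n)
    (hy1 : 1 ≤ y.2) (hy : y.2 ≤ a * n) :
    StHom a ((syz a)^[r] x) y ↔ StHom a ((syz a)^[d - r] y) ((syz a)^[d + 1] x) := by
  rw [stHom_dual (syz_iterate_valid r hx1 hx).2, ← Function.iterate_succ_apply' (syz a),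
    ← stHom_iterate (d - r) hy1 hy (syz_iterate_valid _ hx1 hx).1 (syz_iterate_valid _ hx1 hx).2,
    ← Function.iterate_add_apply, show d - r + r.succ = d + 1 by omega]

end

/-! ### Necessary conditions on `(a, n, d)` -/

namespace IsCombCT
variable {a n d : ℕ} {U : Set (ZMod n × ℕ)} (hU : IsCombCT a n d U)
include hU

lemma not_stHom {x y : ZMod n × ℕ} (hx : x ∈ U) (hy : y ∈ U) {r : ℕ} (h1 : 1 ≤ r) (h2 : r < d) :
    ¬ StHom a ((syz a)^[r] x) y :=
  (hU.mem_left x (hU.valid x hx).1 (hU.valid x hx).2).1 hx y hy r h1 h2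

/-- Ext^r into Ω^(d+1) `x` is dual to Ext^(d-r) out of `x`, and `r ↦ d - r` preserves the range `1 ≤
r < d`. -/
lemma serre_mem {x : ZMod n × ℕ} (hx : x ∈ U) : (syz a)^[d + 1] x ∈ U := by
  obtain ⟨h1, h2⟩ := hU.valid x hx
  obtain ⟨h3, h4⟩ := syz_iterate_valid (a := a) (d + 1) h1 h2
  rw [hU.mem_right _ h3 h4]
  intro y hy r hr1 hr2 h
  obtain ⟨h5, h6⟩ := hU.valid y hy
  refine hU.not_stHom hx hy (r := d - r) (by omega) (by omega) ?_
  rw [stHom_serre (d := d) (by omega) h1 h2 h5 h6, show d - (d - r) = r by omega]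
  exact h

lemma serre_mul_mem {x : ZMod n × ℕ} (hx : x ∈ U) (m : ℕ) : (syz a)^[(d + 1) * m] x ∈ U := by
  induction m with
  | zero => exact hx
  | succ m ih => rw [mul_add, mul_one, add_comm, Function.iterate_add_apply]; exact hU.serre_mem ih

/-- Modulo Ω^(d+1) the exponent may be taken in `1, …, d` if not divisible. An exponent `r < d`
makes an identity map a non-zero class in Ext^r; for exponent `d`, the next translate Ω^(d+1) is one
syzygy further and gives a non-zero Ext^1. -/
lemma dvd_of_mem (hd : 2 ≤ d) {x : ZMod n × ℕ} (hx : x ∈ U) {e : ℕ} (he : (syz a)^[e] x ∈ U) :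
    d + 1 ∣ e := by
  by_contra hne
  have hmod : 0 < e % (d + 1) := Nat.pos_of_ne_zero fun h => hne (Nat.dvd_of_mod_eq_zero h)
  have hlt : e % (d + 1) < d + 1 := Nat.mod_lt _ (by omega)
  have hz := hU.serre_mul_mem hx (e / (d + 1))
  rw [← Nat.mod_add_div e (d + 1), Function.iterate_add_apply] at he
  generalize (syz a)^[(d + 1) * (e / (d + 1))] x = z at hz he
  obtain hr | hr := Nat.lt_or_ge (e % (d + 1)) d
  · exact hU.not_stHom hz he hmod hr (stHom_self (hU.valid _ he).1 (hU.valid _ he).2)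
  · rw [show e % (d + 1) = d by omega] at he
    have h := hU.serre_mem hz
    refine hU.not_stHom he h le_rfl (by omega) ?_
    rw [Function.iterate_one, ← Function.iterate_succ_apply' (syz a)]
    exact stHom_self (hU.valid _ h).1 (hU.valid _ h).2

lemma nonempty (h : 1 ≤ a * n) : U.Nonempty := by
  by_contra hne
  rw [Set.not_nonempty_iff_eq_empty] at hne
  have := (hU.mem_left (0, 1) le_rfl h).2 (by simp [hne])
  simp [hne] at this

lemma dvd_two_mul (hd : 2 ≤ d) (h : 1 ≤ a * n) : d + 1 ∣ 2 * n := by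
  obtain ⟨x, hx⟩ := hU.nonempty h
  exact hU.dvd_of_mem hd hx (by rwa [syz_iterate_period (hU.valid x hx).2])

/-- For `d ≥ 3`, cluster tilting objects are sums of projectives and syzygies of simples. -/
lemma quasiSimple (hd : 3 ≤ d) {x : ZMod n × ℕ} (hx : x ∈ U) : x.2 = 1 ∨ x.2 = a * n := by
  by_contra hne
  obtain ⟨h1, h2⟩ := hU.valid x hx
  have h3 := syz_iterate_valid (a := a) 3 h1 h2
  -- Ext^(d-2) from `x` to Ω^(d+1) `x` is the stable Hom from `x` to Ω^3 `x`. For `2 ≤ l ≤ a * n -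
  -- 1` it contains a map with image of length two.
  refine hU.not_stHom hx (hU.serre_mem hx) (r := d - 2) (by omega) (by omega) ?_
  rw [show d + 1 = (d - 2) + 3 by omega, Function.iterate_add_apply, stHom_iterate _ h1 h2 h3.1 h3.2,
    show 3 = 2 * 1 + 1 by rfl, syz_iterate_odd h2]
  refine ⟨2, by omega, by omega, by simp only; omega, by simp only; omega, ?_⟩
  simp only [add_assoc]
  rw [← Nat.cast_add, ← Nat.cast_add, show 1 + (x.2 + (a * n + 1 - x.2)) = a * n + 2 by omega]
  simp

/-- For `d = 2` the exponent `d - 2` is not available, so `x` is tested against Ω^6 `x`: Ext^1 is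
then the stable Hom from `x` to Ω^5 `x`, which contains a map with image of length three unless `l`
is within two steps of an end of the range. -/
lemma length_of_two (hd : d = 2) {x : ZMod n × ℕ} (hx : x ∈ U) :
    x.2 = 1 ∨ x.2 = 2 ∨ x.2 + 1 = a * n ∨ x.2 = a * n := by
  by_contra hne
  obtain ⟨h1, h2⟩ := hU.valid x hx
  subst hd
  have h3 := syz_iterate_valid (a := a) 5 h1 h2
  refine hU.not_stHom hx (hU.serre_mul_mem hx 2) (r := 1) (by omega) (by omega) ?_
  rw [show (2 + 1) * 2 = 1 + 5 by rfl, Function.iterate_add_apply, stHom_iterate _ h1 h2 h3.1 h3.2,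
    show 5 = 2 * 2 + 1 by rfl, syz_iterate_odd h2]
  refine ⟨3, by omega, by omega, by simp only; omega, by simp only; omega, ?_⟩
  simp only [add_assoc]
  rw [← Nat.cast_add, ← Nat.cast_add, show 2 + (x.2 + (a * n + 1 - x.2)) = a * n + 3 by omega]
  simp

/-- If all objects are syzygies of simples, then `U` contains the objects which a single orbit
cannot see. -/
lemma mem_of_quasiSimple (hd : 2 ≤ d) (hn : 1 ≤ n) (ha : 1 ≤ a)
    (hq : ∀ x ∈ U, x.2 = 1 ∨ x.2 = a * n)
    {l m : ℕ} (h1 : 1 ≤ l) (h2 : l ≤ a * n) (hl : 2 * l = (d + 1) * m + 1 ∨ 2 * l = (d + 1) * m + 2) :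
    l = 1 ∨ l = a * n := by
  have han : 1 ≤ a * n := Nat.mul_pos ha hn
  obtain ⟨s, hs⟩ := hU.dvd_two_mul hd han
  -- A module of length `a * n` is the syzygy of a simple, so `ε` is `0` or `1`.
  obtain ⟨ε, i, hε⟩ : ∃ (ε : ℕ) (i : ZMod n), (syz a)^[ε] (i, 1) ∈ U := by
    obtain ⟨x, hx⟩ := hU.nonempty han
    obtain h | h := hq x hx
    · exact ⟨0, x.1, by rw [← h]; exact hx⟩
    · refine ⟨1, x.1 - 1, ?_⟩
      rw [Function.iterate_one]
      convert hx using 1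
      ext
      · simp [syz]
      · simp [syz, h]
  -- The modules of lengths `1` and `a * n` form a single Ω-orbit.
  have horb : ∀ y ∈ U, ∃ e : ℕ, y = (syz a)^[e] (i, 1) := by
    have : NeZero n := ⟨by omega⟩
    intro y hy
    obtain h | h := hq y hy
    · refine ⟨2 * (y.1 - i).val, ?_⟩
      rw [syz_iterate_even (by simpa using han)]
      ext <;> simp [h]
    · refine ⟨2 * (y.1 - i - 1).val + 1, ?_⟩
      rw [syz_iterate_odd (by simpa using han)]
      ext
      · simp only [ZMod.natCast_val, ZMod.cast_id', id_eq, Nat.cast_one]; ring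
      · simp [h]
  have hY := syz_iterate_valid (a := a) (x := ((i, l) : ZMod n × ℕ)) ε h1 h2
  have hmem : (syz a)^[ε] ((i, l) : ZMod n × ℕ) ∈ U := by
    rw [hU.mem_left _ hY.1 hY.2]
    intro y hy r hr1 hr2 hst
    obtain ⟨e, rfl⟩ := horb y hy
    have hv1 : (1 : ℕ) ≤ ((i, 1) : ZMod n × ℕ).2 := le_rfl
    -- choose `w` with `ε + w ≡ e` modulo the period
    obtain ⟨w, hw⟩ : ∃ w, w + e = 2 * n * (e + ε) + ε := by
      refine ⟨2 * n * (e + ε) + ε - e, ?_⟩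
      have : e ≤ 2 * n * (e + ε) := by nlinarith
      omega
    have hwd : d + 1 ∣ w := by
      have hz : (syz a)^[2 * n * (e + ε) + ε] ((i, 1) : ZMod n × ℕ) ∈ U := by
        rw [Function.iterate_add_apply, syz_iterate_period_mul (syz_iterate_valid ε hv1 han).2]
        exact hε
      rw [← hw, Function.iterate_add_apply] at hz
      exact hU.dvd_of_mem hd hy hz
    obtain ⟨w', rfl⟩ := hwd
    have hv := syz_iterate_valid (a := a) (x := ((i, 1) : ZMod n × ℕ)) e hv1 han
    rw [← Function.iterate_add_apply] at hst
    have hvl := syz_iterate_valid (a := a) (x := ((i, l) : ZMod n × ℕ)) (r + ε) h1 h2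
    -- shift `hst` by `w` and cancel the shift by `ε`
    rw [← stHom_iterate ((d + 1) * w') hvl.1 hvl.2 hv.1 hv.2, ← Function.iterate_add_apply,
      ← Function.iterate_add_apply, hw, show (d + 1) * w' + (r + ε) = ε + ((d + 1) * w' + r) by ring,
      show 2 * n * (e + ε) + ε = ε + 2 * n * (e + ε) by ring,
      Function.iterate_add_apply (syz a) ε, Function.iterate_add_apply (syz a) ε,
      syz_iterate_period_mul han,
      stHom_iterate ε (syz_iterate_valid _ h1 h2).1 (syz_iterate_valid _ h1 h2).2 hv1 han] at hst
    -- The source is now a syzygy of `(i, l)` of order divisible by `d + 1` plus `r`, and its top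
    -- must be `i`. In even order this makes the order a multiple of `2 * n`, so `d + 1 ∣ r`. In odd
    -- order, order plus `2 * l` is `1` modulo `2 * n`, and the hypothesis on `2 * l` gives `d + 1 ∣
    -- r` or `d + 1 ∣ r + 1`. All are impossible for `1 ≤ r < d`.
    obtain ⟨k, hk | hk⟩ := Nat.even_or_odd' ((d + 1) * w' + r)
    · rw [hk, syz_iterate_even h2, stHom_simple h1 h2] at hst
      have hk0 : ((k : ℕ) : ZMod n) = 0 := by simpa using hst
      rw [ZMod.natCast_eq_zero_iff] at hk0
      obtain ⟨q, rfl⟩ := hk0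
      have : d + 1 ∣ r := (Nat.dvd_add_right (Dvd.intro w' rfl)).1
        (hk ▸ ⟨s * q, by rw [← mul_assoc, hs, mul_assoc]⟩)
      exact absurd (Nat.le_of_dvd (by omega) this) (by omega)
    · rw [hk, syz_iterate_odd h2, stHom_simple (by omega) (by omega)] at hst
      have hk0 : ((k + l : ℕ) : ZMod n) = 0 := by
        push_cast
        linear_combination hst
      rw [ZMod.natCast_eq_zero_iff] at hk0
      obtain ⟨q, hq⟩ := hk0
      have hsum : (d + 1) * w' + r + 2 * l = (d + 1) * (s * q) + 1 := by
        rw [← mul_assoc, ← hs, mul_assoc, ← hq, hk]; ring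
      obtain hl | hl := hl
      · have : d + 1 ∣ r := (Nat.dvd_add_right (Dvd.intro (w' + m) rfl)).1
          (show d + 1 ∣ (d + 1) * (w' + m) + r from ⟨s * q, by linarith⟩)
        exact absurd (Nat.le_of_dvd (by omega) this) (by omega)
      · have : d + 1 ∣ r + 1 := (Nat.dvd_add_right (Dvd.intro (w' + m) rfl)).1
          (show d + 1 ∣ (d + 1) * (w' + m) + (r + 1) from ⟨s * q, by linarith⟩)
        exact absurd (Nat.le_of_dvd (by omega) this) (by omega)
  have := hq _ hmem
  obtain ⟨k, rfl | rfl⟩ := Nat.even_or_odd' ε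
  · rwa [syz_iterate_even h2] at this
  · rw [syz_iterate_odd h2] at this
    simp only at this
    omega

lemma shift_mem (hd : d = 2) {i : ZMod n} {l : ℕ} (h : (i, l) ∈ U) : (i + 3, l) ∈ U := by
  subst hd
  have := hU.serre_mul_mem h 2
  rwa [show (2 + 1) * 2 = 2 * 3 by rfl, syz_iterate_even (hU.valid _ h).2] at this

lemma swap_mem (hd : d = 2) {i : ZMod n} {l : ℕ} (h : (i, l) ∈ U) :
    (i + l + 1, a * n + 1 - l) ∈ U := by
  subst hd
  have := hU.serre_mem h
  rw [show 2 + 1 = 2 * 1 + 1 by rfl, syz_iterate_odd (hU.valid _ h).2] at this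
  convert this using 2
  push_cast
  ring

/-- Objects incompatible with a module of length two. -/
lemma not_mem_of_two (hd : d = 2) (h6 : 6 ≤ a * n) {i : ZMod n} (hi : (i, 2) ∈ U) {j : ZMod n}
    {l : ℕ} (hj : (j, l) ∈ U) {c : ℕ} (hc1 : 1 ≤ c) (hc : c ≤ 2) (hcl : c ≤ l) (hlc : l < c + 2)
    (hij : i + 2 + c = j + l) : False := by
  refine hU.not_stHom hi hj le_rfl (by omega) ⟨c, ?_, hc1, hcl, ?_, ?_⟩
  · simp only [Function.iterate_one, syz]; omega
  · simp only [Function.iterate_one, syz]; omega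
  · simpa [syz] using hij

/-- With `(i, 2)` in `U`, anything in `U` obstructing `(i, 5)` would already be incompatible with
`(i, 2)` or its translate `(i + 3, 2)`. Hence `(i, 5)` would lie in `U`, although `5` is not an
admissible length once `a * n ≥ 9`. -/
lemma two_not_mem (hd : d = 2) (h9 : 9 ≤ a * n) (i : ZMod n) : (i, 2) ∉ U := by
  intro hi
  have hY : ((i, 5) : ZMod n × ℕ) ∈ U := by
    rw [hU.mem_left _ (by simp) (by simp only; omega)]
    rintro ⟨j, l⟩ hy r hr1 hr2 hst
    obtain rfl : r = 1 := by omega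
    rw [Function.iterate_one] at hst
    obtain ⟨c, h1, h2, h3, h4, h5⟩ := hst
    have hi3 := hU.shift_mem hd hi
    have hsw := hU.swap_mem hd hy
    simp only [syz] at h1 h3 h4 h5
    have hlen := hU.length_of_two hd hy
    simp only at hlen
    obtain rfl | rfl | hl | hl := hlen
    · obtain rfl : c = 1 := by omega
      refine hU.not_mem_of_two hd (by omega) hi3 hy (c := 1) le_rfl (by omega) le_rfl (by omega) ?_
      rw [← h5]; push_cast; ring
    · refine hU.not_mem_of_two hd (by omega) hi3 hy (c := c) h2 h3 h3 (by omega) ?_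
      rw [← h5]; push_cast; ring
    -- For the two long lengths the obstruction is replaced by its Ω^3-translate, which has length
    -- two or one, and compared with `(i, 2)`.
    · have e2 : a * n + 1 - l = 2 := by omega
      obtain ⟨c', rfl⟩ : ∃ c', l = c + c' := ⟨l - c, by omega⟩
      rw [e2] at hsw
      have e : ((c + c' + 1 : ℕ) : ZMod n) = 0 := by
        rw [hl]; simp
      push_cast at e h5
      refine hU.not_mem_of_two hd (by omega) hi hsw (c := 5 - c') (by omega) (by omega)
        (by omega) (by omega) ?_
      rw [Nat.cast_sub (by omega)]
      push_cast
      linear_combination h5 - e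
    · have e2 : a * n + 1 - l = 1 := by omega
      obtain rfl : l = c + 4 := by omega
      rw [e2] at hsw
      have e : ((c + 4 : ℕ) : ZMod n) = 0 := by
        rw [hl]; simp
      push_cast at e h5
      refine hU.not_mem_of_two hd (by omega) hi hsw (c := 1) le_rfl (by omega)
        (by omega) (by omega) ?_
      push_cast
      linear_combination h5 - e
  have := hU.length_of_two hd hY
  simp only at this
  omega

theorem mem_list (hd : 2 ≤ d) (hn : 1 ≤ n) (ha : 1 ≤ a) :
    (a, n, d) ∈ ({p : ℕ × ℕ × ℕ | ∃ t : ℕ, 2 ≤ t ∧ p = (1, t, 2 * t - 1)} ∪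
        {(1, 3, 2), (1, 6, 2), (2, 3, 2)} : Set (ℕ × ℕ × ℕ)) := by
  have han : 1 ≤ a * n := Nat.mul_pos ha hn
  obtain ⟨s, hs⟩ := hU.dvd_two_mul hd han
  have hs0 : s ≠ 0 := by rintro rfl; omega
  obtain hd3 | rfl := Nat.lt_or_eq_of_le hd
  · left
    have key := fun l m h1 h2 hl =>
      hU.mem_of_quasiSimple hd hn ha (fun x hx => hU.quasiSimple hd3 hx) (l := l) (m := m) h1 h2 hl
    have hna : n ≤ a * n := Nat.le_mul_of_pos_left n ha
    -- The test length is the smallest `l > 1` with `2 * l` equal to `d + 2` or `d + 3`: `e + 1` for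
    -- even `d` and `e + 2` for odd `d`. It lies strictly below `a * n` except when `a = 1` and `n =
    -- e + 1`.
    obtain ⟨e, rfl | rfl⟩ := Nat.even_or_odd' d
    · exfalso
      obtain ⟨s', rfl⟩ : 2 ∣ s := by
        have : 2 ∣ (2 * e + 1) * s := ⟨n, hs.symm⟩
        exact (Nat.Coprime.dvd_mul_left (by simp)).1 this
      have hn' : n = (2 * e + 1) * s' := by nlinarith
      have : 2 * e + 1 ≤ n := by rw [hn']; exact Nat.le_mul_of_pos_right _ (by omega)
      have := key (e + 1) 1 (by omega) (by omega) (by omega)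
      omega
    · have hn' : n = (e + 1) * s := by nlinarith
      have hle : e + 1 ≤ n := by rw [hn']; exact Nat.le_mul_of_pos_right _ (by omega)
      obtain hs1 | hs1 := Nat.lt_or_ge 1 s
      · exfalso
        have : (e + 1) * 2 ≤ n := by rw [hn']; exact Nat.mul_le_mul_left _ hs1
        have := key (e + 2) 1 (by omega) (by omega) (by omega)
        omega
      · obtain rfl : s = 1 := by omega
        obtain ha1 | ha1 := Nat.lt_or_ge 1 a
        · exfalso
          have : 2 * n ≤ a * n := Nat.mul_le_mul_right _ ha1
          have := key (e + 2) 1 (by omega) (by omega) (by omega)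
          omega
        · exact ⟨n, by omega, by simp; omega⟩
  · right
    obtain ⟨n', rfl⟩ : 3 ∣ n := by omega
    by_cases h9 : 9 ≤ a * (3 * n')
    · exfalso
      have hq : ∀ x ∈ U, x.2 = 1 ∨ x.2 = a * (3 * n') := by
        rintro ⟨i, l⟩ hx
        obtain h | h | h | h := hU.length_of_two rfl hx
        · exact .inl h
        · simp only at h
          subst h
          exact absurd hx (hU.two_not_mem rfl h9 i)
        · simp only at h
          have := hU.swap_mem rfl hx
          rw [show a * (3 * n') + 1 - l = 2 by omega] at this
          exact absurd this (hU.two_not_mem rfl h9 _)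
        · exact .inr h
      have := hU.mem_of_quasiSimple le_rfl hn ha hq (l := 2) (m := 1) (by omega) (by omega)
        (by omega)
      omega
    · have h3 : a * n' < 3 := by nlinarith
      have hn0 : 1 ≤ n' := by omega
      have ha3 : a < 3 := by nlinarith
      have hn3 : n' < 3 := by nlinarith
      interval_cases a <;> interval_cases n' <;> simp at h3 ⊢

end IsCombCT

/-! ### Construction of combinatorial cluster tilting sets -/

/-- For `d = 2` only `r = 1` occurs, and bounding the lengths by an interval makes both conditions
decidable. -/
lemma isCombCT_of_finset {a n : ℕ} (U : Finset (ZMod n × ℕ))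
    (hv : ∀ x ∈ U, 1 ≤ x.2 ∧ x.2 ≤ a * n)
    (h1 : ∀ i : ZMod n, ∀ l ∈ Finset.Icc 1 (a * n),
      ((i, l) ∈ U ↔ ∀ y ∈ U, ¬ StHom a (syz a (i, l)) y))
    (h2 : ∀ i : ZMod n, ∀ l ∈ Finset.Icc 1 (a * n),
      ((i, l) ∈ U ↔ ∀ y ∈ U, ¬ StHom a (syz a y) (i, l))) :
    IsCombCT a n 2 (U : Set (ZMod n × ℕ)) where
  valid := hv
  mem_left x hx1 hx2 := by
    rw [Finset.mem_coe, h1 x.1 x.2 (by simp [hx1, hx2])]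
    refine forall₂_congr fun y hy => ⟨fun h r hr1 hr2 => ?_, fun h => h 1 le_rfl (by omega)⟩
    obtain rfl : r = 1 := by omega
    exact h
  mem_right x hx1 hx2 := by
    rw [Finset.mem_coe, h2 x.1 x.2 (by simp [hx1, hx2])]
    refine forall₂_congr fun y hy => ⟨fun h r hr1 hr2 => ?_, fun h => h 1 le_rfl (by omega)⟩
    obtain rfl : r = 1 := by omega
    exact h

/-- Here and in the next two cases the set is the closure of `(0, 1)` and `(0, 2)` under Ω^3, as
`serre_mem` requires. -/
lemma isCombCT_one_three : IsCombCT 1 3 2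
    (({(0, 1), (0, 2), (2, 3)} : Finset (ZMod 3 × ℕ)) : Set (ZMod 3 × ℕ)) :=
  isCombCT_of_finset _ (by decide) (by decide) (by decide)

lemma isCombCT_two_three : IsCombCT 2 3 2
    (({(0, 1), (0, 2), (0, 5), (2, 6)} : Finset (ZMod 3 × ℕ)) : Set (ZMod 3 × ℕ)) :=
  isCombCT_of_finset _ (by decide) (by decide) (by decide)

lemma isCombCT_one_six : IsCombCT 1 6 2
    (({(0, 1), (0, 2), (0, 5), (2, 6), (3, 1), (3, 2), (3, 5), (5, 6)} :
      Finset (ZMod 6 × ℕ)) : Set (ZMod 6 × ℕ)) :=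
  isCombCT_of_finset _ (by decide) (by decide +kernel) (by decide +kernel)

/-- Here `d + 1 = 2 * t` is the period of Ω. Among its syzygies of orders strictly between `0` and
`d`, the simple `(0, 1)` never has top `0`, whereas every other module does reach top `0`. -/
lemma isCombCT_simple {t : ℕ} (ht : 2 ≤ t) :
    IsCombCT 1 t (2 * t - 1) ({(0, 1)} : Set (ZMod t × ℕ)) := by
  have hl : ∀ x : ZMod t × ℕ, 1 ≤ x.2 → x.2 ≤ 1 * t →
      (x ∈ ({(0, 1)} : Set (ZMod t × ℕ)) ↔ ∀ y ∈ ({(0, 1)} : Set (ZMod t × ℕ)), ∀ r, 1 ≤ r →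
        r < 2 * t - 1 → ¬ StHom 1 ((syz 1)^[r] x) y) := by
    have : NeZero t := ⟨by omega⟩
    rintro ⟨i, l⟩ h1 h2
    simp only [Set.mem_singleton_iff, forall_eq] at h1 h2 ⊢
    constructor
    · rintro h r hr1 hr2
      obtain ⟨rfl, rfl⟩ := Prod.mk.inj h
      obtain ⟨k, rfl | rfl⟩ := Nat.even_or_odd' r
      · rw [syz_iterate_even h2, stHom_simple h1 h2]
        simp only [zero_add]
        rw [ZMod.natCast_eq_zero_iff]
        exact fun h => absurd (Nat.le_of_dvd (by omega) h) (by omega)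
      · rw [syz_iterate_odd h2, stHom_simple (by omega) (by omega)]
        simp only [zero_add]
        rw [← Nat.cast_add, ZMod.natCast_eq_zero_iff]
        exact fun h => absurd (Nat.le_of_dvd (by omega) h) (by omega)
    · intro h
      have hi : i = 0 := by
        by_contra hi
        have hpos : (-i).val ≠ 0 := by simpa using hi
        have hlt := ZMod.val_lt (-i)
        refine h (2 * (-i).val) (by omega) (by omega) ?_
        rw [syz_iterate_even h2, stHom_simple h1 h2]
        simp
      subst hi
      by_contra hl1
      have hl2 : l ≠ 1 := fun h => hl1 (by rw [h])
      -- The odd syzygy of order `2 * k + 1` of `(0, l)` has top `k + l`, which vanishes modulo `t`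
      -- for `k = t - l`; `l ≥ 2` keeps the order below `2 * t - 1`.
      refine h (2 * (t - l) + 1) (by omega) (by omega) ?_
      rw [syz_iterate_odd h2, stHom_simple (by omega) (by omega), Nat.cast_sub (by omega)]
      simp
  refine ⟨by simp; omega, hl, fun x hx1 hx2 => ?_⟩
  rw [hl x hx1 hx2]
  simp only [Set.mem_singleton_iff, forall_eq]
  -- Serre duality with Ω^(d+1) acting trivially exchanges the left and right conditions.
  have key : ∀ r, 1 ≤ r → r < 2 * t - 1 →
      (StHom 1 ((syz 1)^[r] x) (0, 1) ↔ StHom 1 ((syz 1)^[2 * t - 1 - r] (0, 1)) x) := by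
    intro r hr1 hr2
    rw [stHom_serre (d := 2 * t - 1) (by omega) hx1 hx2 le_rfl (by simp; omega),
      show 2 * t - 1 + 1 = 2 * t by omega, syz_iterate_period hx2]
  constructor
  · intro h r hr1 hr2
    have := h (2 * t - 1 - r) (by omega) (by omega)
    rwa [key _ (by omega) (by omega), show 2 * t - 1 - (2 * t - 1 - r) = r by omega] at this
  · intro h r hr1 hr2
    rw [key r hr1 hr2]
    exact h _ (by omega) (by omega)

theorem exists_isCombCT {a n d : ℕ}
    (h : (a, n, d) ∈ ({p : ℕ × ℕ × ℕ | ∃ t : ℕ, 2 ≤ t ∧ p = (1, t, 2 * t - 1)} ∪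
        {(1, 3, 2), (1, 6, 2), (2, 3, 2)} : Set (ℕ × ℕ × ℕ))) :
    ∃ U : Finset (ZMod n × ℕ), IsCombCT a n d (U : Set (ZMod n × ℕ)) := by
  simp only [Set.mem_union, Set.mem_ofPred_eq, Prod.mk.injEq, Set.mem_insert_iff,
    Set.mem_singleton_iff] at h
  obtain ⟨t, ht, rfl, rfl, rfl⟩ | ⟨rfl, rfl, rfl⟩ | ⟨rfl, rfl, rfl⟩ | ⟨rfl, rfl, rfl⟩ := h
  · exact ⟨{(0, 1)}, by simpa using isCombCT_simple ht⟩
  · exact ⟨_, isCombCT_one_three⟩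
  · exact ⟨_, isCombCT_one_six⟩
  · exact ⟨_, isCombCT_two_three⟩

/-! ### Extension groups -/

section Ext
variable {R : Type u} [Ring R]

open Abelian

/-- Factoring the identity through finitely many objects treats retracts, finite powers, two-term
decompositions and the zero module (empty sum) uniformly. -/
lemma subsingleton_ext_of_sum_left {ι : Type} [Fintype ι] {X Y : ModuleCat.{u} R}
    (Z : ι → ModuleCat.{u} R) (p : ∀ a, X ⟶ Z a) (q : ∀ a, Z a ⟶ X)
    (h : ∑ a, p a ≫ q a = 𝟙 X) {r : ℕ} (hZ : ∀ a, Subsingleton (Ext (Z a) Y r)) :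
    Subsingleton (Ext X Y r) := by
  refine subsingleton_of_forall_eq 0 fun e => ?_
  rw [← Ext.mk₀_id_comp e, ← h, Ext.mk₀_sum, Ext.sum_comp]
  refine Finset.sum_eq_zero fun a _ => ?_
  rw [← Ext.mk₀_comp_mk₀_assoc, Subsingleton.elim ((Ext.mk₀ (q a)).comp e (zero_add r)) 0,
    Ext.comp_zero]

lemma subsingleton_ext_of_sum_right {ι : Type} [Fintype ι] {X Y : ModuleCat.{u} R}
    (Z : ι → ModuleCat.{u} R) (p : ∀ a, Y ⟶ Z a) (q : ∀ a, Z a ⟶ Y)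
    (h : ∑ a, p a ≫ q a = 𝟙 Y) {r : ℕ} (hZ : ∀ a, Subsingleton (Ext X (Z a) r)) :
    Subsingleton (Ext X Y r) := by
  refine subsingleton_of_forall_eq 0 fun e => ?_
  rw [← Ext.comp_mk₀_id e, ← h, Ext.mk₀_sum, Ext.comp_sum]
  refine Finset.sum_eq_zero fun a _ => ?_
  rw [← Ext.mk₀_comp_mk₀, ← Ext.comp_assoc e (Ext.mk₀ (p a)) (Ext.mk₀ (q a)) (add_zero r)
    (add_zero 0) (by omega), Subsingleton.elim (e.comp (Ext.mk₀ (p a)) (add_zero r)) 0,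
    Ext.zero_comp]

lemma subsingleton_ext_of_retract_left {X X' Y : ModuleCat.{u} R} (s : X →ₗ[R] X')
    (p : X' →ₗ[R] X) (h : p ∘ₗ s = LinearMap.id) {r : ℕ} (hX : Subsingleton (Ext X' Y r)) :
    Subsingleton (Ext X Y r) :=
  subsingleton_ext_of_sum_left (ι := Unit) (fun _ => X') (fun _ => ModuleCat.ofHom s)
    (fun _ => ModuleCat.ofHom p) (by simp [← ModuleCat.ofHom_comp, h]) fun _ => hX

lemma subsingleton_ext_of_retract_right {X Y Y' : ModuleCat.{u} R} (s : Y →ₗ[R] Y')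
    (p : Y' →ₗ[R] Y) (h : p ∘ₗ s = LinearMap.id) {r : ℕ} (hX : Subsingleton (Ext X Y' r)) :
    Subsingleton (Ext X Y r) :=
  subsingleton_ext_of_sum_right (ι := Unit) (fun _ => Y') (fun _ => ModuleCat.ofHom s)
    (fun _ => ModuleCat.ofHom p) (by simp [← ModuleCat.ofHom_comp, h]) fun _ => hX

/-- Direct summands of finite powers. -/
lemma subsingleton_ext_of_addClosure_left {X M Y : ModuleCat.{u} R} (hX : addClosure R M X)
    {r : ℕ} (h : Subsingleton (Ext M Y r)) : Subsingleton (Ext X Y r) := by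
  obtain ⟨m, s, p, hps⟩ := hX
  refine subsingleton_ext_of_retract_left (X' := ModuleCat.of R (Fin m → M)) s p hps ?_
  refine subsingleton_ext_of_sum_left (fun _ => M)
    (fun a => ModuleCat.ofHom (LinearMap.proj a)) (fun a => ModuleCat.ofHom (LinearMap.single R (fun _ : Fin m => (M : Type u)) a))
    ?_ fun _ => h
  ext x
  simp [← ModuleCat.ofHom_comp, ModuleCat.hom_sum]

lemma subsingleton_ext_of_addClosure_right {X M Y : ModuleCat.{u} R} (hX : addClosure R M Y)
    {r : ℕ} (h : Subsingleton (Ext X M r)) : Subsingleton (Ext X Y r) := by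
  obtain ⟨m, s, p, hps⟩ := hX
  refine subsingleton_ext_of_retract_right (Y' := ModuleCat.of R (Fin m → M)) s p hps ?_
  refine subsingleton_ext_of_sum_right (fun _ => M)
    (fun a => ModuleCat.ofHom (LinearMap.proj a)) (fun a => ModuleCat.ofHom (LinearMap.single R (fun _ : Fin m => (M : Type u)) a))
    ?_ fun _ => h
  ext x
  simp [← ModuleCat.ofHom_comp, ModuleCat.hom_sum]

variable {P X Y : Type u} [AddCommGroup P] [Module R P] [AddCommGroup X] [Module R X]
  [AddCommGroup Y] [Module R Y]

/-- Dimension shifting: the middle term of the kernel sequence is projective. -/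
lemma subsingleton_ext_succ_iff [Module.Projective R P] {f : P →ₗ[R] X}
    (hf : Function.Surjective f) {r : ℕ} :
    Subsingleton (Ext (ModuleCat.of R X) (ModuleCat.of R Y) (r + 2)) ↔
      Subsingleton (Ext (ModuleCat.of R (LinearMap.ker f)) (ModuleCat.of R Y) (r + 1)) := by
  have hS := LinearMap.shortExact_shortComplexKer hf
  have : Projective f.shortComplexKer.X₂ := (IsProjective.iff_projective P).1 inferInstance
  constructor
  · intro h
    refine subsingleton_of_forall_eq 0 fun e => ?_
    obtain ⟨x₂, hx₂⟩ := Ext.contravariant_sequence_exact₁ hS (ModuleCat.of R Y) e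
      (show 1 + (r + 1) = r + 2 by omega) (@Subsingleton.elim _ h _ _)
    rw [← hx₂, Ext.eq_zero_of_projective x₂, Ext.comp_zero]
  · intro h
    refine subsingleton_of_forall_eq 0 fun e => ?_
    obtain ⟨x₁, hx₁⟩ := Ext.contravariant_sequence_exact₃ hS (ModuleCat.of R Y) e
      (Ext.eq_zero_of_projective _) (show 1 + (r + 1) = r + 2 by omega)
    rw [← hx₁, @Subsingleton.elim _ h x₁ 0, Ext.comp_zero]

/-- Ext^1 is the cokernel of restriction from the projective cover to the kernel, so it vanishes
exactly when restriction is onto. -/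
lemma subsingleton_ext_one_iff [Module.Projective R P] {f : P →ₗ[R] X}
    (hf : Function.Surjective f) :
    Subsingleton (Ext (ModuleCat.of R X) (ModuleCat.of R Y) 1) ↔
      ∀ g : LinearMap.ker f →ₗ[R] Y, ∃ h : P →ₗ[R] Y, h ∘ₗ (LinearMap.ker f).subtype = g := by
  have hS := LinearMap.shortExact_shortComplexKer hf
  have : Projective f.shortComplexKer.X₂ := (IsProjective.iff_projective P).1 inferInstance
  constructor
  · intro h g
    obtain ⟨x₂, hx₂⟩ := Ext.contravariant_sequence_exact₁ hS (ModuleCat.of R Y)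
      (Ext.mk₀ (ModuleCat.ofHom g)) (show 1 + 0 = 1 by omega) (@Subsingleton.elim _ h _ _)
    obtain ⟨k, rfl⟩ := (Ext.mk₀_bijective _ _).2 x₂
    rw [Ext.mk₀_comp_mk₀] at hx₂
    have := (Ext.mk₀_bijective _ _).1 hx₂
    exact ⟨k.hom, by simpa using congrArg ModuleCat.Hom.hom this⟩
  · intro h
    refine subsingleton_of_forall_eq 0 fun e => ?_
    obtain ⟨x₁, hx₁⟩ := Ext.contravariant_sequence_exact₃ hS (ModuleCat.of R Y) e
      (Ext.eq_zero_of_projective _) (show 1 + 0 = 1 by omega)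
    obtain ⟨k, rfl⟩ := (Ext.mk₀_bijective _ _).2 x₁
    obtain ⟨g, hg⟩ := h k.hom
    have hk : k = f.shortComplexKer.f ≫ ModuleCat.ofHom g := by
      ext1
      simpa using hg.symm
    rw [← hx₁, hk, ← Ext.mk₀_comp_mk₀, ← Ext.comp_assoc _ _ _ (add_zero 1) (add_zero 0) (by omega),
      hS.extClass_comp, Ext.zero_comp]

end Ext

/-! ### Lengths and uniserial modules -/

section Length
variable (R : Type u) [Ring R]

/-- The composition length as a natural number. -/
noncomputable def len (M : Type u) [AddCommGroup M] [Module R M] : ℕ :=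
  (Module.length R M).toNat

variable {R}
variable [IsArtinianRing R]
variable {M N : Type u} [AddCommGroup M] [Module R M] [AddCommGroup N] [Module R N]

/-- Finitely generated modules over an Artinian ring have finite length, so `toNat` loses nothing.
-/
lemma coe_len [Module.Finite R M] : (len R M : ℕ∞) = Module.length R M :=
  ENat.natCast_toNat Module.length_ne_top

omit [IsArtinianRing R] in
lemma len_congr (e : M ≃ₗ[R] N) : len R M = len R N := by
  rw [len, len, e.length_eq]

lemma len_eq_zero_iff [Module.Finite R M] : len R M = 0 ↔ Subsingleton M := by
  rw [← Module.length_eq_zero_iff (R := R), ← coe_len]; simp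

lemma len_pos_iff [Module.Finite R M] : 0 < len R M ↔ Nontrivial M := by
  rw [Nat.pos_iff_ne_zero, ne_eq, len_eq_zero_iff, not_subsingleton_iff_nontrivial]

lemma len_eq_one_iff [Module.Finite R M] : len R M = 1 ↔ IsSimpleModule R M := by
  rw [← Module.length_eq_one_iff, ← coe_len]; simp

lemma len_submodule_add [Module.Finite R M] (K : Submodule R M) :
    len R K + len R (M ⧸ K) = len R M := by
  have := Module.length_eq_add_of_exact K.subtype K.mkQ K.injective_subtype K.mkQ_surjective
    (LinearMap.exact_subtype_mkQ K)
  rw [← coe_len, ← coe_len, ← coe_len] at this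
  exact_mod_cast this.symm

lemma len_ker_add_range [Module.Finite R M] (f : M →ₗ[R] N) :
    len R (LinearMap.ker f) + len R (LinearMap.range f) = len R M := by
  rw [← len_congr f.quotKerEquivRange, len_submodule_add]

lemma len_ker_add [Module.Finite R M] {f : M →ₗ[R] N} (hf : Function.Surjective f) :
    len R (LinearMap.ker f) + len R N = len R M := by
  rw [← len_congr (f.quotKerEquivOfSurjective hf), len_submodule_add]

omit [IsArtinianRing R] in
lemma len_range_of_injective {f : M →ₗ[R] N} (hf : Function.Injective f) :
    len R (LinearMap.range f) = len R M :=
  (len_congr (LinearEquiv.ofInjective f hf)).symm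

lemma len_lt_len [Module.Finite R M] {K L : Submodule R M} (h : K < L) :
    len R K < len R L := by
  have := Submodule.height_strictMono h
  rw [← Module.length_submodule, ← Module.length_submodule, ← coe_len, ← coe_len] at this
  exact_mod_cast this

lemma len_mono [Module.Finite R M] {K L : Submodule R M} (h : K ≤ L) : len R K ≤ len R L := by
  obtain rfl | h := h.eq_or_lt
  · rfl
  · exact (len_lt_len h).le

omit [IsArtinianRing R] in
lemma len_top : len R (⊤ : Submodule R M) = len R M := len_congr Submodule.topEquiv

lemma len_submodule_le [Module.Finite R M] (K : Submodule R M) : len R K ≤ len R M := by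
  rw [← len_submodule_add K]; omega

lemma eq_of_le_of_len_le [Module.Finite R M] {K L : Submodule R M} (h : K ≤ L)
    (hl : len R L ≤ len R K) : K = L := by
  by_contra hne
  exact absurd (len_lt_len (lt_of_le_of_ne h hne)) (by omega)

lemma eq_bot_of_len_eq_zero [Module.Finite R M] {K : Submodule R M} (hl : len R K = 0) :
    K = ⊥ := by
  rw [len_eq_zero_iff] at hl
  exact (Submodule.subsingleton_iff_eq_bot).1 hl

lemma len_pos_of_ne_bot [Module.Finite R M] {K : Submodule R M} (hK : K ≠ ⊥) : 0 < len R K := by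
  rw [len_pos_iff]
  exact (Submodule.nontrivial_iff_ne_bot).2 hK

lemma len_le_of_surjective [Module.Finite R M] {f : M →ₗ[R] N} (hf : Function.Surjective f) :
    len R N ≤ len R M := by
  rw [← len_ker_add hf]; omega

lemma injective_of_surjective_of_len_le [Module.Finite R M] {f : M →ₗ[R] N}
    (hf : Function.Surjective f) (h : len R M ≤ len R N) : Function.Injective f := by
  rw [← LinearMap.ker_eq_bot]
  refine eq_bot_of_len_eq_zero ?_
  have := len_ker_add hf
  omega

omit [IsArtinianRing R] in
/-- A non-zero finitely generated module has a simple quotient. -/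
lemma exists_simple_quotient (M : Type u) [AddCommGroup M] [Module R M] [Module.Finite R M]
    [Nontrivial M] : ∃ K : Submodule R M, IsSimpleModule R (M ⧸ K) := by
  obtain ⟨K, hK, -⟩ := (eq_top_or_exists_le_coatom (⊥ : Submodule R M)).resolve_left bot_ne_top
  exact ⟨K, isSimpleModule_iff_isCoatom.2 hK⟩

lemma exists_simple_submodule (M : Type u) [AddCommGroup M] [Module R M] [Module.Finite R M]
    [Nontrivial M] : ∃ K : Submodule R M, IsSimpleModule R K := by
  obtain ⟨K, hK, -⟩ := (eq_bot_or_exists_atom_le (⊤ : Submodule R M)).resolve_left top_ne_bot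
  exact ⟨K, isSimpleModule_iff_isAtom.2 hK⟩

/-- Induction along decompositions into indecomposable modules. -/
theorem decomposition_induction
    {motive : ∀ (M : Type u) [AddCommGroup M] [Module R M], Prop}
    (zero : ∀ (M : Type u) [AddCommGroup M] [Module R M], Subsingleton M → motive M)
    (indec : ∀ (M : Type u) [AddCommGroup M] [Module R M], Module.Finite R M →
      IsIndecomposableModule R M → motive M)
    (sum : ∀ (M : Type u) [AddCommGroup M] [Module R M], Module.Finite R M →
      ∀ K L : Submodule R M, IsCompl K L → motive K → motive L → motive M)
    (M : Type u) [AddCommGroup M] [Module R M] [hM : Module.Finite R M] : motive M := by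
  obtain ⟨m, hm⟩ : ∃ m, len R M = m := ⟨_, rfl⟩
  induction m using Nat.strong_induction_on generalizing M with
  | _ m ih =>
    obtain h | h := subsingleton_or_nontrivial M
    · exact zero M h
    by_cases hi : IsIndecomposableModule R M
    · exact indec M hM hi
    · obtain ⟨K, L, hKL, hK, hL⟩ : ∃ K L : Submodule R M, IsCompl K L ∧ K ≠ ⊥ ∧ L ≠ ⊥ := by
        by_contra! hcon
        exact hi ⟨h, fun K L hKL => or_iff_not_imp_left.2 fun hK => hcon K L hKL hK⟩
      have hK' : K ≠ ⊤ := fun h => hL (by simpa [h] using hKL.inf_eq_bot)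
      have hL' : L ≠ ⊤ := fun h => hK (by simpa [h] using hKL.inf_eq_bot)
      refine sum M hM K L hKL (ih _ ?_ K rfl) (ih _ ?_ L rfl)
      · rw [← hm, ← len_top (M := M)]
        exact len_lt_len (lt_of_le_of_ne le_top hK')
      · rw [← hm, ← len_top (M := M)]
        exact len_lt_len (lt_of_le_of_ne le_top hL')

end Length

/-! ### Uniserial modules -/

section Uniserial
variable {R : Type u} [Ring R]
variable {M N : Type u} [AddCommGroup M] [Module R M] [AddCommGroup N] [Module R N]

lemma IsUniserial.of_injective (hN : IsUniserial R N) {f : M →ₗ[R] N} (hf : Function.Injective f) :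
    IsUniserial R M := fun K L => by
  refine (hN (K.map f) (L.map f)).imp ?_ ?_ <;>
  exact (Submodule.map_le_map_iff_of_injective hf _ _).1

lemma IsUniserial.of_surjective (hM : IsUniserial R M) {f : M →ₗ[R] N}
    (hf : Function.Surjective f) : IsUniserial R N := fun K L => by
  refine (hM (K.comap f) (L.comap f)).imp ?_ ?_ <;>
  exact (Submodule.comap_le_comap_iff_of_surjective hf).1

lemma IsUniserial.submodule (hM : IsUniserial R M) (K : Submodule R M) : IsUniserial R K :=
  hM.of_injective K.injective_subtype

lemma IsUniserial.quotient (hM : IsUniserial R M) (K : Submodule R M) : IsUniserial R (M ⧸ K) :=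
  hM.of_surjective K.mkQ_surjective

lemma IsUniserial.range (hM : IsUniserial R M) (f : M →ₗ[R] N) :
    IsUniserial R (LinearMap.range f) :=
  hM.of_surjective f.surjective_rangeRestrict

lemma IsUniserial.indecomposable [Nontrivial M] (hM : IsUniserial R M) :
    IsIndecomposableModule R M := by
  refine ⟨inferInstance, fun K L h => ?_⟩
  obtain h' | h' := hM K L
  · left; simpa [inf_eq_left.2 h'] using h.inf_eq_bot
  · right; simpa [inf_eq_right.2 h'] using h.inf_eq_bot

lemma IsUniserial.of_isSimpleModule [IsSimpleModule R M] : IsUniserial R M := fun K L => by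
  obtain rfl | rfl := eq_bot_or_eq_top K
  · left; exact bot_le
  · right; exact le_top

/-- A map to a uniserial module is surjective if it is so modulo a simple quotient. -/
lemma IsUniserial.surjective_of_comp_ne_zero {T : Type u} [AddCommGroup T] [Module R T]
    [IsSimpleModule R T] (hN : IsUniserial R N) {q : N →ₗ[R] T} {f : M →ₗ[R] N}
    (h : q ∘ₗ f ≠ 0) : Function.Surjective f := by
  have hq : q ≠ 0 := by rintro rfl; simp at h
  have hco : IsCoatom (LinearMap.ker q) :=
    LinearMap.isCoatom_ker_of_surjective (LinearMap.surjective_of_ne_zero hq)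
  rw [← LinearMap.range_eq_top]
  obtain h' | h' := hN (LinearMap.range f) (LinearMap.ker q)
  · exact absurd (LinearMap.range_le_ker_iff.1 h') h
  · obtain h1 | h1 := h'.eq_or_lt
    · exact absurd (LinearMap.range_le_ker_iff.1 h1.ge) h
    · exact hco.2 _ h1

/-- Both kernels are maximal submodules, and a chain has at most one coatom. -/
lemma IsUniserial.ker_eq {S T : Type u} [AddCommGroup T] [Module R T]
    [IsSimpleModule R T] [AddCommGroup S] [Module R S] [IsSimpleModule R S]
    (hM : IsUniserial R M) {f : M →ₗ[R] S} {g : M →ₗ[R] T} (hf : f ≠ 0) (hg : g ≠ 0) :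
    LinearMap.ker f = LinearMap.ker g := by
  have hf' : IsCoatom (LinearMap.ker f) :=
    LinearMap.isCoatom_ker_of_surjective (LinearMap.surjective_of_ne_zero hf)
  have hg' : IsCoatom (LinearMap.ker g) :=
    LinearMap.isCoatom_ker_of_surjective (LinearMap.surjective_of_ne_zero hg)
  obtain h | h := hM (LinearMap.ker f) (LinearMap.ker g)
  · exact h.eq_of_not_lt fun h => hg'.1 (hf'.2 _ h)
  · exact (h.eq_of_not_lt fun h => hf'.1 (hg'.2 _ h)).symm

/-- A uniserial module has at most one simple quotient. -/
lemma IsUniserial.nonempty_equiv {S T : Type u} [AddCommGroup T] [Module R T]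
    [IsSimpleModule R T] [AddCommGroup S] [Module R S] [IsSimpleModule R S]
    (hM : IsUniserial R M) {f : M →ₗ[R] S} {g : M →ₗ[R] T} (hf : f ≠ 0) (hg : g ≠ 0) :
    Nonempty (S ≃ₗ[R] T) :=
  ⟨(f.quotKerEquivOfSurjective (LinearMap.surjective_of_ne_zero hf)).symm ≪≫ₗ
    Submodule.quotEquivOfEq _ _ (hM.ker_eq hf hg) ≪≫ₗ
    g.quotKerEquivOfSurjective (LinearMap.surjective_of_ne_zero hg)⟩

/-- In a chain the simple submodule `T` lies in every non-zero submodule, so a kernel not containing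
`T` is zero. -/
lemma IsUniserial.injective_of_ne_zero {T : Submodule R M} [IsSimpleModule R T]
    (hM : IsUniserial R M) {f : M →ₗ[R] N} (h : f ∘ₗ T.subtype ≠ 0) : Function.Injective f := by
  rw [← LinearMap.ker_eq_bot]
  have hT : IsAtom T := isSimpleModule_iff_isAtom.1 inferInstance
  have hle : ¬ T ≤ LinearMap.ker f := fun hle => h (by ext x; exact hle x.2)
  exact hT.2 _ (lt_of_le_not_ge ((hM T _).resolve_left hle) hle)

section Artinian
variable [IsArtinianRing R] [Module.Finite R M]

lemma IsUniserial.le_of_len_le (hM : IsUniserial R M) {K L : Submodule R M}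
    (h : len R K ≤ len R L) : K ≤ L := by
  obtain h' | h' := hM K L
  · exact h'
  · exact (eq_of_le_of_len_le h' h).ge

lemma IsUniserial.eq_of_len_eq (hM : IsUniserial R M) {K L : Submodule R M}
    (h : len R K = len R L) : K = L :=
  le_antisymm (hM.le_of_len_le h.le) (hM.le_of_len_le h.ge)

omit [Module.Finite R M] in
lemma exists_submodule_len (M : Type u) [AddCommGroup M] [Module R M] [Module.Finite R M]
    {c : ℕ} (hc : c ≤ len R M) : ∃ K : Submodule R M, len R K = c := by
  obtain ⟨m, hm⟩ : ∃ m, len R M = m := ⟨_, rfl⟩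
  induction m generalizing M with
  | zero => exact ⟨⊤, by rw [len_top]; omega⟩
  | succ m ih =>
    obtain rfl | hlt := hc.eq_or_lt
    · exact ⟨⊤, len_top⟩
    have : Nontrivial M := by rw [← len_pos_iff (R := R)]; omega
    obtain ⟨L, hL⟩ := exists_simple_quotient (R := R) M
    have h1 := len_submodule_add L
    rw [(len_eq_one_iff (R := R)).2 hL] at h1
    obtain ⟨K, hK⟩ := ih L (by omega) (by omega)
    exact ⟨K.map L.subtype, by rw [← hK, len_congr (K.equivMapOfInjective _ L.injective_subtype)]⟩

/-- Quotients of a uniserial module are determined by their length. -/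
lemma IsUniserial.quotient_equiv {X Y : Type u} [AddCommGroup X] [Module R X] [AddCommGroup Y]
    [Module R Y] (hM : IsUniserial R M) {f : M →ₗ[R] X} {g : M →ₗ[R] Y}
    (hf : Function.Surjective f) (hg : Function.Surjective g) (h : len R X = len R Y) :
    Nonempty (X ≃ₗ[R] Y) := by
  have h1 := len_ker_add hf
  have h2 := len_ker_add hg
  exact ⟨(f.quotKerEquivOfSurjective hf).symm ≪≫ₗ
    Submodule.quotEquivOfEq _ _ (hM.eq_of_len_eq (by omega)) ≪≫ₗ g.quotKerEquivOfSurjective hg⟩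

end Artinian
end Uniserial

/-! ### Indecomposable modules are uniserial -/

/-- The properties of right modules over symmetric Nakayama algebras from which the structure of
the module category is derived. -/
structure IsSymmNakayamaRing (R : Type u) [Ring R] : Prop where
  injective : Module.Injective R R
  uniserial : ∀ (P : Type u) [AddCommGroup P] [Module R P], Module.Finite R P →
    Module.Projective R P → IsIndecomposableModule R P → IsUniserial R P
  socle : ∀ (P : Type u) [AddCommGroup P] [Module R P], Module.Finite R P →
    Module.Projective R P → IsIndecomposableModule R P → ∀ T : Submodule R P, IsSimpleModule R T →
    ∃ f : P →ₗ[R] T, f ≠ 0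

section
variable {R : Type u} [Ring R]

lemma projective_of_isCompl {M : Type u} [AddCommGroup M] [Module R M] [Module.Projective R M]
    {K L : Submodule R M} (h : IsCompl K L) : Module.Projective R K :=
  Module.Projective.of_split K.subtype (K.projectionOnto L h)
    (by ext x; simp)

/-- Every non-zero map from a finitely generated projective module is non-zero on the image of some
indecomposable projective module. -/
lemma exists_indecomposable_projective [IsArtinianRing R] {T : Type u} [AddCommGroup T] [Module R T]
    (F : Type u) [AddCommGroup F] [Module R F] [Module.Finite R F] :
    Module.Projective R F → ∀ g : F →ₗ[R] T, g ≠ 0 →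
    ∃ P : ModuleCat.{u} R, Module.Finite R P ∧ Module.Projective R P ∧ IsIndecomposableModule R P ∧
      ∃ f : P →ₗ[R] T, f ≠ 0 := by
  refine decomposition_induction (R := R) (motive := fun F _ _ => Module.Projective R F →
    ∀ g : F →ₗ[R] T, g ≠ 0 → _) ?_ ?_ ?_ F
  · intro M _ _ hM _ g hg
    exact absurd (LinearMap.ext fun x => by rw [Subsingleton.elim x 0]; simp) hg
  · intro M _ _ hM hi hp g hg
    exact ⟨ModuleCat.of R M, hM, hp, hi, g, hg⟩
  · intro M _ _ hM K L hKL hK hL hp g hg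
    by_cases hgK : g ∘ₗ K.subtype = 0
    · refine hL (projective_of_isCompl hKL.symm) (g ∘ₗ L.subtype) fun hgL => hg ?_
      rw [← LinearMap.ker_eq_top, eq_top_iff, ← hKL.sup_eq_top]
      refine sup_le (fun x hx => ?_) fun x hx => ?_
      · exact LinearMap.congr_fun hgK ⟨x, hx⟩
      · exact LinearMap.congr_fun hgL ⟨x, hx⟩
    · exact hK (projective_of_isCompl hKL) _ hgK

variable [IsArtinianRing R]

/-- A non-zero element gives a non-zero map from the regular module, hence from one of its
indecomposable summands. -/
lemma exists_cover_simple (T : Type u) [AddCommGroup T] [Module R T] [IsSimpleModule R T] :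
    ∃ P : ModuleCat.{u} R, Module.Finite R P ∧ Module.Projective R P ∧ IsIndecomposableModule R P ∧
      ∃ f : P →ₗ[R] T, f ≠ 0 := by
  have := IsSimpleModule.nontrivial R T
  obtain ⟨x, hx⟩ := exists_ne (0 : T)
  refine exists_indecomposable_projective R inferInstance (LinearMap.toSpanSingleton R T x) ?_
  intro h
  exact hx (by simpa using LinearMap.congr_fun h 1)

/-- Non-zero uniserial modules have an indecomposable projective cover. -/
lemma IsUniserial.exists_cover {M : Type u} [AddCommGroup M] [Module R M] [Module.Finite R M]
    [Nontrivial M] (hM : IsUniserial R M) :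
    ∃ P : ModuleCat.{u} R, Module.Finite R P ∧ Module.Projective R P ∧ IsIndecomposableModule R P ∧
      ∃ f : P →ₗ[R] M, Function.Surjective f := by
  obtain ⟨K, hK⟩ := exists_simple_quotient (R := R) M
  obtain ⟨P, h1, h2, h3, f, hf⟩ := exists_cover_simple (R := R) (M ⧸ K)
  obtain ⟨g, hg⟩ := Module.projective_lifting_property K.mkQ f K.mkQ_surjective
  exact ⟨P, h1, h2, h3, g, hM.surjective_of_comp_ne_zero (q := K.mkQ) (by rwa [hg])⟩

namespace IsSymmNakayamaRing
variable (hR : IsSymmNakayamaRing R)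
include hR

omit [IsArtinianRing R] in
lemma injective_of_projective (P : Type u) [AddCommGroup P] [Module R P] [Module.Finite R P]
    [Module.Projective R P] : Module.Injective R P := by
  obtain ⟨m, p, hp⟩ := Module.Finite.exists_fin' R P
  obtain ⟨s, hs⟩ := Module.projective_lifting_property p LinearMap.id hp
  constructor
  intro X Y _ _ _ _ f hf g
  have := hR.injective
  choose h hh using fun a : Fin m => Module.Injective.out f hf (LinearMap.proj a ∘ₗ s ∘ₗ g)
  refine ⟨p ∘ₗ LinearMap.pi h, fun x => ?_⟩
  have : LinearMap.pi h (f x) = s (g x) := by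
    ext a
    simpa using hh a x
  rw [LinearMap.comp_apply, this]
  exact LinearMap.congr_fun hs (g x)

/-- Every simple module embeds into its projective cover. -/
lemma exists_simple_embedding {T P : Type u} [AddCommGroup T] [Module R T] [IsSimpleModule R T]
    [AddCommGroup P] [Module R P] [Module.Finite R P] [Module.Projective R P]
    (hP : IsIndecomposableModule R P) {f : P →ₗ[R] T} (hf : f ≠ 0) :
    ∃ j : T →ₗ[R] P, Function.Injective j := by
  have := hP.1
  obtain ⟨K, hK⟩ := exists_simple_submodule (R := R) P
  obtain ⟨g, hg⟩ := hR.socle P inferInstance inferInstance hP K hK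
  obtain ⟨e⟩ := (hR.uniserial P inferInstance inferInstance hP).nonempty_equiv hf hg
  exact ⟨K.subtype ∘ₗ e.toLinearMap, K.injective_subtype.comp e.injective⟩

/-- Injective hulls of uniserial modules. -/
lemma exists_hull {V P : Type u} [AddCommGroup V] [Module R V]
    (hV : IsUniserial R V) {T : Submodule R V} [IsSimpleModule R T]
    [AddCommGroup P] [Module R P] [Module.Finite R P] [Module.Projective R P]
    (hP : IsIndecomposableModule R P) {f : P →ₗ[R] T} (hf : f ≠ 0) :
    ∃ j : V →ₗ[R] P, Function.Injective j := by
  obtain ⟨j, hj⟩ := hR.exists_simple_embedding hP hf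
  have := hR.injective_of_projective P
  obtain ⟨h, hh⟩ := Module.Injective.out T.subtype T.injective_subtype j
  have hcomp : h ∘ₗ T.subtype = j := LinearMap.ext hh
  refine ⟨h, hV.injective_of_ne_zero (T := T) ?_⟩
  rw [hcomp]
  have := IsSimpleModule.nontrivial R T
  exact LinearMap.ne_zero_of_injective hj

/-- Indecomposable finitely generated modules are quotients of indecomposable projectives. -/
theorem exists_cover_of_indecomposable {M : Type u} [AddCommGroup M] [Module R M]
    [Module.Finite R M] (hM : IsIndecomposableModule R M) :
    ∃ P : ModuleCat.{u} R, Module.Finite R P ∧ Module.Projective R P ∧ IsIndecomposableModule R P ∧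
      ∃ f : P →ₗ[R] M, Function.Surjective f := by
  have := hM.1
  -- Choose a map from an indecomposable projective to `M` with image `V` of maximal length. The aim
  -- is to show that `V` is a direct summand.
  set s : Set ℕ := {c | ∃ P : ModuleCat.{u} R, Module.Finite R P ∧ Module.Projective R P ∧
    IsIndecomposableModule R P ∧ ∃ f : P →ₗ[R] M, len R (LinearMap.range f) = c}
  have hbdd : BddAbove s := ⟨len R M, by
    rintro _ ⟨P, -, -, -, f, rfl⟩
    exact len_submodule_le _⟩
  obtain ⟨K, hK⟩ := exists_simple_submodule (R := R) M
  have hone : 1 ∈ s := by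
    obtain ⟨P, h1, h2, h3, f, hf⟩ := exists_cover_simple (R := R) K
    refine ⟨P, h1, h2, h3, K.subtype ∘ₗ f, ?_⟩
    rw [LinearMap.range_comp_of_range_eq_top _
      (LinearMap.range_eq_top.2 (LinearMap.surjective_of_ne_zero hf)), Submodule.range_subtype,
      len_eq_one_iff]
    exact hK
  obtain ⟨P, hP1, hP2, hP3, g, hg⟩ := Nat.sSup_mem ⟨1, hone⟩ hbdd
  have hmax : ∀ c ∈ s, c ≤ len R (LinearMap.range g) := fun c hc => hg ▸ le_csSup hbdd hc
  have hgpos := hmax 1 hone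
  set V := LinearMap.range g
  have hVu : IsUniserial R V := (hR.uniserial P hP1 hP2 hP3).range g
  have hVn : Nontrivial V := by rw [← len_pos_iff (R := R)]; omega
  obtain ⟨T, hT⟩ := exists_simple_submodule (R := R) V
  obtain ⟨P', h1, h2, h3, f', hf'⟩ := exists_cover_simple (R := R) T
  obtain ⟨j, hj⟩ := hR.exists_hull (T := T) hVu h3 hf'
  have := hR.injective_of_projective P'
  obtain ⟨f, hf⟩ := Module.Injective.out V.subtype V.injective_subtype j
  have hle : LinearMap.range j ≤ LinearMap.range f := by
    rintro _ ⟨x, rfl⟩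
    exact ⟨x, hf x⟩
  have hlj := len_range_of_injective hj
  have hWn : Nontrivial (LinearMap.range f) := by
    have := len_mono hle
    rw [← len_pos_iff (R := R)]; omega
  have hWu : IsUniserial R (LinearMap.range f) := (hR.uniserial P' h1 h2 h3).submodule _
  obtain ⟨Q, hQ1, hQ2, hQ3, q, hq⟩ := hWu.exists_cover
  -- The image of `f : M → P'` is uniserial, hence covered by some `Q`. Lifting this cover to `M`
  -- gives an image at least as long as that of `f`, so by maximality `f` has no larger image than
  -- its restriction `j` to `V`.
  obtain ⟨k, hk⟩ := Module.projective_lifting_property f.rangeRestrict q f.surjective_rangeRestrict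
  have hkl : len R (LinearMap.range f) ≤ len R (LinearMap.range k) := by
    refine len_le_of_surjective (f := f.rangeRestrict ∘ₗ (LinearMap.range k).subtype) ?_
    intro w
    obtain ⟨x, rfl⟩ := hq w
    exact ⟨⟨k x, x, rfl⟩, LinearMap.congr_fun hk x⟩
  have heq : LinearMap.range j = LinearMap.range f :=
    eq_of_le_of_len_le hle (by rw [hlj]; exact hkl.trans (hmax _ ⟨Q, hQ1, hQ2, hQ3, k, rfl⟩))
  -- the retraction onto `V`
  let r : M →ₗ[R] V := (LinearEquiv.ofInjective j hj).symm.toLinearMap ∘ₗ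
    f.codRestrict (LinearMap.range j) (fun x => heq ▸ LinearMap.mem_range_self f x)
  have hr : ∀ x : V, r x = x := by
    intro x
    apply (LinearEquiv.ofInjective j hj).injective
    ext
    simp [r, ← hf x]
  have hcompl := LinearMap.isCompl_of_proj hr
  have htop : V = ⊤ := by
    obtain h | h := hM.2 _ _ hcompl
    · exact absurd h ((Submodule.nontrivial_iff_ne_bot).1 hVn)
    · simpa [h] using hcompl.sup_eq_top
  exact ⟨P, hP1, hP2, hP3, g, LinearMap.range_eq_top.1 htop⟩

theorem uniserial_of_indecomposable {M : Type u} [AddCommGroup M] [Module R M]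
    [Module.Finite R M] (hM : IsIndecomposableModule R M) : IsUniserial R M := by
  obtain ⟨P, h1, h2, h3, f, hf⟩ := hR.exists_cover_of_indecomposable hM
  exact (hR.uniserial P h1 h2 h3).of_surjective hf

end IsSymmNakayamaRing
end

/-! ### Symmetric algebras -/

/-- A symmetrising form, given by its characteristic properties. -/
structure IsSymmetrizing (k : Type v) (R : Type u) [Field k] [Ring R] [Algebra k R]
    (μ : R →ₗ[k] k) : Prop where
  comm : ∀ x y, μ (x * y) = μ (y * x)
  eq_zero : ∀ x, (∀ r, μ (r * x) = 0) → x = 0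
  represent : ∀ F : R →ₗ[k] k, ∃ b, ∀ x, F x = μ (x * b)

/-- The form is the value `φ 1`: bimodule linearity gives `φ b y = φ 1 (b * y) = φ 1 (y * b)`. -/
lemma IsSymmetricAlgebra.exists_isSymmetrizing {k : Type v} {B : Type u} [Field k] [Ring B]
    [Algebra k B] (h : IsSymmetricAlgebra k B) : ∃ μ : Bᵐᵒᵖ →ₗ[k] k, IsSymmetrizing k Bᵐᵒᵖ μ := by
  obtain ⟨φ, hφ⟩ := h
  have h1 : ∀ b y, φ b y = φ 1 (b * y) := fun b y => by simpa using hφ 1 1 b y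
  have h2 : ∀ b y, φ b y = φ 1 (y * b) := fun b y => by simpa using hφ b 1 1 y
  refine ⟨φ 1 ∘ₗ (MulOpposite.opLinearEquiv k).symm.toLinearMap, ?_, ?_, ?_⟩
  · intro x y
    simp only [LinearMap.comp_apply, LinearEquiv.coe_coe, MulOpposite.coe_opLinearEquiv_symm,
      MulOpposite.unop_mul]
    rw [← h1, h2]
  · intro x hx
    rw [← MulOpposite.unop_eq_zero_iff, ← φ.map_eq_zero_iff]
    ext y
    rw [h1]
    simpa using hx (MulOpposite.op y)
  · intro F
    obtain ⟨b, hb⟩ := φ.surjective (F ∘ₗ (MulOpposite.opLinearEquiv k).toLinearMap)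
    refine ⟨MulOpposite.op b, fun x => ?_⟩
    have := LinearMap.congr_fun hb x.unop
    rw [h1] at this
    simpa using this.symm

section
variable {k : Type v} {R : Type u} [Field k] [Ring R] [Algebra k R] {μ : R →ₗ[k] k}

lemma IsSymmetrizing.ext (hμ : IsSymmetrizing k R μ) {x y : R} (h : ∀ r, μ (r * x) = μ (r * y)) :
    x = y :=
  sub_eq_zero.1 (hμ.eq_zero _ fun r => by rw [mul_sub, map_sub, h, sub_self])

/-- Baer's criterion: extend `μ ∘ g` linearly to the whole ring and represent it as `μ (· * b)`.
Non-degeneracy then shows that `g` is right multiplication by `b`. -/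
lemma IsSymmetrizing.injective (hμ : IsSymmetrizing k R μ) : Module.Injective R R := by
  refine Module.Baer.injective fun I g => ?_
  obtain ⟨F, hF⟩ := LinearMap.exists_extend (p := I.restrictScalars k) (μ ∘ₗ g.restrictScalars k)
  obtain ⟨b, hb⟩ := hμ.represent F
  refine ⟨LinearMap.toSpanSingleton R R b, fun x hx => hμ.ext fun r => ?_⟩
  have := LinearMap.congr_fun hF ⟨r * x, I.mul_mem_left r hx⟩
  rw [LinearMap.comp_apply, Submodule.subtype_apply, hb] at this
  rw [LinearMap.toSpanSingleton_apply, smul_eq_mul, ← mul_assoc, this]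
  change μ (g (r • ⟨x, hx⟩)) = _
  rw [map_smul, smul_eq_mul]

/-- If there were no non-zero map, the coordinates of `P` would annihilate `T`. Expanding `μ (r * s
t a)` in the dual basis and exchanging factors under `μ` makes those annihilations visible, so all
coordinates of `t` vanish. -/
lemma IsSymmetrizing.socle (hμ : IsSymmetrizing k R μ) (P : Type u) [AddCommGroup P] [Module R P]
    [Module.Finite R P] [Module.Projective R P] (T : Submodule R P) (hT : T ≠ ⊥) :
    ∃ f : P →ₗ[R] T, f ≠ 0 := by
  by_contra! hcon
  obtain ⟨m, p, hp⟩ := Module.Finite.exists_fin' R P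
  obtain ⟨s, hs⟩ := Module.projective_lifting_property p LinearMap.id hp
  have hzero : ∀ (a : Fin m) (z : P) (t : P), t ∈ T → s z a • t = 0 := by
    intro a z t ht
    have := LinearMap.congr_fun
      (hcon (LinearMap.toSpanSingleton R T ⟨t, ht⟩ ∘ₗ LinearMap.proj a ∘ₗ s)) z
    simpa using congrArg Subtype.val this
  have hexp : ∀ t : P, t = ∑ b, s t b • p (Pi.single b 1) := by
    intro t
    conv_lhs => rw [← LinearMap.id_apply (R := R) t, ← hs, LinearMap.comp_apply,
      LinearMap.pi_apply_eq_sum_univ p (s t)]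
    refine Finset.sum_congr rfl fun b _ => ?_
    congr 2
    ext c
    simp [Pi.single_apply, eq_comm]
  refine hT ((Submodule.eq_bot_iff _).2 fun t ht => ?_)
  have hst : s t = 0 := by
    ext a
    refine hμ.eq_zero _ fun r => ?_
    have h1 : r * s t a = ∑ b, s (r • t) b * s (p (Pi.single b 1)) a := by
      have := congrArg (fun z => s z a) (hexp (r • t))
      simpa [map_sum, Finset.sum_apply] using this
    rw [h1, map_sum]
    refine Finset.sum_eq_zero fun b _ => ?_
    rw [hμ.comm, ← smul_eq_mul, ← Pi.smul_apply, ← map_smul,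
      hzero a _ _ (T.smul_mem r ht)]
    simp
  have := LinearMap.congr_fun hs t
  rw [LinearMap.comp_apply, hst, map_zero] at this
  exact this.symm

end

theorem isSymmNakayamaRing {k : Type v} {B : Type u} [Field k] [Ring B]
    [Algebra k B] (h : IsSymmetricAlgebra k B) (hB : IsNakayama B) :
    IsSymmNakayamaRing Bᵐᵒᵖ := by
  obtain ⟨μ, hμ⟩ := h.exists_isSymmetrizing
  refine ⟨hμ.injective, fun P _ _ h1 h2 h3 => hB P h1 h3 (.inl h2), fun P _ _ h1 h2 _ T hT => ?_⟩
  exact hμ.socle P T (isSimpleModule_iff_isAtom.1 hT).1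

/-! ### The quiver of a symmetric Nakayama ring -/

/-- Finitely generated indecomposable projective modules. -/
structure IsIndecProj (R : Type u) [Ring R] (P : Type u) [AddCommGroup P] [Module R P] : Prop where
  finite : Module.Finite R P
  projective : Module.Projective R P
  indecomposable : IsIndecomposableModule R P

/-- A complete irredundant list of the indecomposable projective modules. -/
structure IsProjSystem {R : Type u} [Ring R] {ι : Type} (P : ι → ModuleCat.{u} R) : Prop where
  isIndecProj : ∀ i, IsIndecProj R (P i)
  eq_of_equiv : ∀ i j, Nonempty (P i ≃ₗ[R] P j) → i = j
  exists_equiv : ∀ (Q : Type u) [AddCommGroup Q] [Module R Q], IsIndecProj R Q →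
    ∃ i, Nonempty (P i ≃ₗ[R] Q)

section
variable {R : Type u} [Ring R] [IsArtinianRing R]

lemma len_map_add_len_ker {M N : Type u} [AddCommGroup M] [Module R M] [AddCommGroup N] [Module R N]
    [Module.Finite R M] (f : M →ₗ[R] N) {K : Submodule R M} (hK : LinearMap.ker f ≤ K) :
    len R (K.map f) + len R (LinearMap.ker f) = len R K := by
  have h := len_ker_add_range (f ∘ₗ K.subtype)
  rw [LinearMap.range_comp, Submodule.range_subtype, LinearMap.ker_comp,
    len_congr (Submodule.comapSubtypeEquivOfLe hK)] at h
  omega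

namespace IsSymmNakayamaRing
variable (hR : IsSymmNakayamaRing R)
include hR

omit [IsArtinianRing R] in
lemma indecProj_uniserial {P : Type u} [AddCommGroup P] [Module R P] (hP : IsIndecProj R P) :
    IsUniserial R P :=
  hR.uniserial P hP.finite hP.projective hP.indecomposable

/-- Indecomposable projectives with a common simple quotient are isomorphic. -/
lemma equiv_of_simple {P Q T : Type u} [AddCommGroup P] [Module R P] [AddCommGroup Q] [Module R Q]
    [AddCommGroup T] [Module R T] [IsSimpleModule R T] (hP : IsIndecProj R P)
    (hQ : IsIndecProj R Q) {f : P →ₗ[R] T} {g : Q →ₗ[R] T} (hf : f ≠ 0) (hg : g ≠ 0) :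
    Nonempty (P ≃ₗ[R] Q) := by
  have := hP.finite
  have := hQ.finite
  have := hP.projective
  have := hQ.projective
  obtain ⟨h, hh⟩ := Module.projective_lifting_property g f (LinearMap.surjective_of_ne_zero hg)
  obtain ⟨l, hl⟩ := Module.projective_lifting_property f g (LinearMap.surjective_of_ne_zero hf)
  have h1 := (hR.indecProj_uniserial hQ).surjective_of_comp_ne_zero (q := g) (f := h) (by rwa [hh])
  have h2 := (hR.indecProj_uniserial hP).surjective_of_comp_ne_zero (q := f) (f := l) (by rwa [hl])
  exact ⟨LinearEquiv.ofBijective h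
    ⟨injective_of_surjective_of_len_le h1 (len_le_of_surjective h2), h1⟩⟩

lemma equiv_of_surjective {P Q M : Type u} [AddCommGroup P] [Module R P] [AddCommGroup Q]
    [Module R Q] [AddCommGroup M] [Module R M] [Nontrivial M] (hP : IsIndecProj R P)
    (hQ : IsIndecProj R Q) {f : P →ₗ[R] M} {g : Q →ₗ[R] M} (hf : Function.Surjective f)
    (hg : Function.Surjective g) : Nonempty (P ≃ₗ[R] Q) := by
  have := hP.finite
  have : Module.Finite R M := Module.Finite.of_surjective f hf
  obtain ⟨K, hK⟩ := exists_simple_quotient (R := R) M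
  have := IsSimpleModule.nontrivial R (M ⧸ K)
  refine hR.equiv_of_simple (T := M ⧸ K) hP hQ (f := K.mkQ ∘ₗ f) (g := K.mkQ ∘ₗ g) ?_ ?_
  · exact LinearMap.ne_zero_of_surjective (K.mkQ_surjective.comp hf)
  · exact LinearMap.ne_zero_of_surjective (K.mkQ_surjective.comp hg)

lemma exists_isProjSystem {n : ℕ} {S : Fin n → ModuleCat.{u} R}
    (h1 : ∀ i, IsSimpleModule R (S i))
    (h2 : ∀ i j, Nonempty (S i ≃ₗ[R] S j) → i = j)
    (h3 : ∀ T : ModuleCat.{u} R, IsSimpleModule R T → ∃ i, Nonempty (T ≃ₗ[R] S i)) :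
    ∃ P : Fin n → ModuleCat.{u} R, IsProjSystem P := by
  choose P hP1 hP2 hP3 f hf using fun i => exists_cover_simple (R := R) (S i)
  have hP : ∀ i, IsIndecProj R (P i) := fun i => ⟨hP1 i, hP2 i, hP3 i⟩
  refine ⟨P, hP, fun i j ⟨e⟩ => h2 i j ?_, fun Q _ _ hQ => ?_⟩
  · refine (hR.indecProj_uniserial (hP i)).nonempty_equiv (hf i) (g := f j ∘ₗ e.toLinearMap) ?_
    intro h
    refine hf j (LinearMap.ext fun x => ?_)
    simpa using LinearMap.congr_fun h (e.symm x)
  · have := hQ.finite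
    have := hQ.indecomposable.1
    obtain ⟨K, hK⟩ := exists_simple_quotient (R := R) Q
    have := IsSimpleModule.nontrivial R (Q ⧸ K)
    obtain ⟨i, ⟨e⟩⟩ := h3 (ModuleCat.of R (Q ⧸ K)) hK
    have e' : (Q ⧸ K) ≃ₗ[R] S i := e
    have := e'.symm.toEquiv.nontrivial
    have hK0 := LinearMap.ne_zero_of_surjective (f := e'.toLinearMap ∘ₗ K.mkQ)
      (e'.surjective.comp K.mkQ_surjective)
    exact ⟨i, hR.equiv_of_simple (hP i) hQ (hf i) hK0⟩

end IsSymmNakayamaRing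

namespace IsProjSystem
variable {ι : Type} {P : ι → ModuleCat.{u} R} (hP : IsProjSystem P) (hR : IsSymmNakayamaRing R)
include hP

lemma exists_cover {M : Type u} [AddCommGroup M] [Module R M] [Module.Finite R M]
    [Nontrivial M] (hM : IsUniserial R M) : ∃ i, ∃ f : P i →ₗ[R] M, Function.Surjective f := by
  obtain ⟨Q, h1, h2, h3, f, hf⟩ := hM.exists_cover
  obtain ⟨i, ⟨e⟩⟩ := hP.exists_equiv Q ⟨h1, h2, h3⟩
  exact ⟨i, f ∘ₗ e.toLinearMap, hf.comp e.surjective⟩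

lemma exists_cover_simple (T : Type u) [AddCommGroup T] [Module R T] [IsSimpleModule R T] :
    ∃ i, ∃ f : P i →ₗ[R] T, f ≠ 0 := by
  have := IsSimpleModule.nontrivial R T
  obtain ⟨i, f, hf⟩ := hP.exists_cover (IsUniserial.of_isSimpleModule (R := R) (M := T))
  exact ⟨i, f, LinearMap.ne_zero_of_surjective hf⟩

lemma one_le_len (i : ι) : 1 ≤ len R (P i) := by
  have := (hP.isIndecProj i).finite
  exact len_pos_iff.2 (hP.isIndecProj i).indecomposable.1

include hR

/-- The radical of an indecomposable projective is covered by another one, or is zero. -/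
lemma exists_next : ∃ π : ι → ι, ∀ i, (len R (P i) = 1 ∧ π i = i) ∨
    2 ≤ len R (P i) ∧ ∃ f : P (π i) →ₗ[R] P i, len R (LinearMap.range f) + 1 = len R (P i) := by
  rw [← Classical.skolem (p := fun i j => (len R (P i) = 1 ∧ j = i) ∨
    2 ≤ len R (P i) ∧ ∃ f : P j →ₗ[R] P i, len R (LinearMap.range f) + 1 = len R (P i))]
  intro i
  have := (hP.isIndecProj i).finite
  obtain h | h := (hP.one_le_len i).eq_or_lt
  -- A simple projective has zero radical; the default `π i = i` keeps every vertex periodic.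
  · exact ⟨i, .inl ⟨h.symm, rfl⟩⟩
  · obtain ⟨K, hK⟩ := exists_submodule_len (R := R) (P i) (Nat.sub_le (len R (P i)) 1)
    have : Nontrivial K := by rw [← len_pos_iff (R := R)]; omega
    obtain ⟨j, f, hf⟩ := hP.exists_cover
      ((hR.indecProj_uniserial (hP.isIndecProj i)).submodule K)
    refine ⟨j, .inr ⟨h, K.subtype ∘ₗ f, ?_⟩⟩
    rw [LinearMap.range_comp_of_range_eq_top _ (LinearMap.range_eq_top.2 hf),
      Submodule.range_subtype]
    omega

variable {π : ι → ι} (hπ : ∀ i, (len R (P i) = 1 ∧ π i = i) ∨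
    2 ≤ len R (P i) ∧ ∃ f : P (π i) →ₗ[R] P i, len R (LinearMap.range f) + 1 = len R (P i))
include hπ

/-- Composing radical maps lowers the image length by exactly one each time, because the kernel of
the map so far is contained in the next radical. -/
lemma exists_iterate (i : ι) {c : ℕ} (hc : c < len R (P i)) :
    ∃ f : P (π^[c] i) →ₗ[R] P i, len R (LinearMap.range f) + c = len R (P i) := by
  induction c with
  | zero =>
    change ∃ f : P i →ₗ[R] P i, len R (LinearMap.range f) = len R (P i)
    exact ⟨LinearMap.id, by rw [LinearMap.range_id, len_top]⟩
  | succ c ih =>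
    obtain ⟨f, hf⟩ := ih (by omega)
    have hfin := (hP.isIndecProj (π^[c] i)).finite
    have hfr := len_ker_add_range f
    obtain ⟨h, -⟩ | ⟨h, g, hg⟩ := hπ (π^[c] i)
    · omega
    · have hle : LinearMap.ker f ≤ LinearMap.range g :=
        (hR.indecProj_uniserial (hP.isIndecProj (π^[c] i))).le_of_len_le (by omega)
      rw [Function.iterate_succ_apply']
      refine ⟨f ∘ₗ g, ?_⟩
      have := len_map_add_len_ker f hle
      rw [LinearMap.range_comp]
      omega

/-- The iterate covers the socle of `P i`, while symmetry makes `P i` itself a cover of its socle.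
-/
lemma iterate_socle (i : ι) : π^[len R (P i) - 1] i = i := by
  have h1 := hP.one_le_len i
  have hfin := (hP.isIndecProj i).finite
  obtain ⟨f, hf⟩ := hP.exists_iterate hR hπ i (c := len R (P i) - 1) (by omega)
  have hs : IsSimpleModule R (LinearMap.range f) := by
    rw [← len_eq_one_iff]; omega
  have := IsSimpleModule.nontrivial R (LinearMap.range f)
  obtain ⟨g, hg⟩ := hR.socle (P i) hfin (hP.isIndecProj i).projective
    (hP.isIndecProj i).indecomposable _ hs
  exact hP.eq_of_equiv _ _ (hR.equiv_of_simple (hP.isIndecProj _) (hP.isIndecProj _)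
    (LinearMap.ne_zero_of_surjective f.surjective_rangeRestrict) hg)

lemma mem_periodicPts (i : ι) : i ∈ Function.periodicPts π := by
  obtain ⟨-, h⟩ | ⟨h, -⟩ := hπ i
  · exact Function.mk_mem_periodicPts one_pos h
  · exact Function.mk_mem_periodicPts (n := len R (P i) - 1) (by omega)
      (hP.iterate_socle hR hπ i)

/-- The image is one of the radical layers of `P j`, as submodules of the same length agree, and its
cover is unique. -/
lemma eq_iterate_of_ne_zero {i j : ι} {f : P i →ₗ[R] P j} (hf : f ≠ 0) : ∃ c, i = π^[c] j := by
  have hfin := (hP.isIndecProj j).finite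
  have hne : LinearMap.range f ≠ ⊥ := by rwa [ne_eq, LinearMap.range_eq_bot]
  have hpos := len_pos_of_ne_bot hne
  have : Nontrivial (LinearMap.range f) := len_pos_iff.1 hpos
  have hle := len_submodule_le (LinearMap.range f)
  obtain ⟨g, hg⟩ := hP.exists_iterate hR hπ j (c := len R (P j) - len R (LinearMap.range f))
    (by omega)
  have heq : LinearMap.range g = LinearMap.range f :=
    (hR.indecProj_uniserial (hP.isIndecProj j)).eq_of_len_eq (by omega)
  refine ⟨_, hP.eq_of_equiv _ _ (hR.equiv_of_surjective (M := LinearMap.range f) (hP.isIndecProj _)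
    (hP.isIndecProj _) f.surjective_rangeRestrict
    (g := (LinearEquiv.ofEq _ _ heq).toLinearMap ∘ₗ g.rangeRestrict) ?_)⟩
  exact (LinearEquiv.ofEq _ _ heq).surjective.comp g.surjective_rangeRestrict

omit hP hR [IsArtinianRing R] hπ in
lemma _root_.Function.exists_iterate_eq_of_mem_periodicPts {π : ι → ι} {i j : ι}
    (hi : i ∈ Function.periodicPts π) {c : ℕ} (h : j = π^[c] i) : ∃ e, i = π^[e] j := by
  obtain ⟨m, hm, hmi⟩ := hi
  have : c ≤ m * c := Nat.le_mul_of_pos_left c hm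
  refine ⟨m * c - c, ?_⟩
  rw [h, ← Function.iterate_add_apply, show m * c - c + c = m * c by omega]
  exact (hmi.mul_const c).symm

/-- The lengths of the indecomposable projectives do not decrease along the quiver. -/
lemma len_le_len_next (i : ι) : len R (P i) ≤ len R (P (π i)) := by
  have hfin := (hP.isIndecProj i).finite
  have hfin' := (hP.isIndecProj (π i)).finite
  have hproj := (hP.isIndecProj (π i)).projective
  obtain ⟨-, h⟩ | ⟨h, f, hf⟩ := hπ i
  · rw [h]
  have hfr := len_ker_add_range f
  -- If the length dropped, the radical map would be injective, hence split by self-injectivity. In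
  -- a uniserial module the kernel of the retraction and the image are comparable, so one vanishes:
  -- either the lengths are contradicted or the identity of `P (π i)` is zero.
  by_contra hlt
  have hinj : Function.Injective f := by
    rw [← LinearMap.ker_eq_bot]
    exact eq_bot_of_len_eq_zero (by omega)
  have := hR.injective_of_projective (P (π i))
  obtain ⟨r, hr⟩ := Module.Injective.out f hinj LinearMap.id
  obtain h' | h' := hR.indecProj_uniserial (hP.isIndecProj i) (LinearMap.ker r) (LinearMap.range f)
  · have hri : Function.Injective r := by
      rw [← LinearMap.ker_eq_bot, Submodule.eq_bot_iff]
      intro x hx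
      obtain ⟨y, rfl⟩ := h' hx
      rw [LinearMap.mem_ker, hr] at hx
      rw [show y = 0 from hx, map_zero]
    have := len_range_of_injective hri
    have := len_submodule_le (LinearMap.range r)
    omega
  · have hnt := (hP.isIndecProj (π i)).indecomposable.1
    obtain ⟨x, hx⟩ := exists_ne (0 : P (π i))
    refine hx ?_
    have := hr x
    rwa [show r (f x) = 0 from h' ⟨x, rfl⟩, eq_comm] at this

end IsProjSystem
end

/-! ### Blocks -/

section
variable {R : Type u} [Ring R]

lemma isRingIndecomposable_mulOpposite {B : Type u} [Ring B] (h : IsRingIndecomposable B) :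
    IsRingIndecomposable Bᵐᵒᵖ := by
  have := h.1
  refine ⟨inferInstance, fun e he hc => ?_⟩
  have := h.2 e.unop ?_ ?_
  · simpa using this
  · have := congrArg MulOpposite.unop he.eq
    rwa [MulOpposite.unop_mul] at this
  · rw [Semigroup.mem_center_iff] at hc ⊢
    intro b
    have := congrArg MulOpposite.unop (hc (MulOpposite.op b))
    simpa using this.symm

/-- Complementary left ideals which are stable under right multiplication come from a central
idempotent. -/
lemma IsRingIndecomposable.eq_bot_or_eq_bot (hR : IsRingIndecomposable R) {I J : Ideal R}
    (h : IsCompl I J) (hI : ∀ x ∈ I, ∀ r, x * r ∈ I) (hJ : ∀ x ∈ J, ∀ r, x * r ∈ J) :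
    I = ⊥ ∨ J = ⊥ := by
  obtain ⟨e, he, f, hf, hef⟩ := Submodule.mem_sup.1 (h.sup_eq_top ▸ Submodule.mem_top (x := (1 : R)))
  have hzero : ∀ x, x ∈ I → x ∈ J → x = 0 := fun x h1 h2 => by
    have : x ∈ I ⊓ J := ⟨h1, h2⟩
    rwa [h.inf_eq_bot] at this
  have hfe : f = 1 - e := by rw [← hef]; abel
  have hcomm : ∀ x, x * e = e * x := by
    intro x
    refine sub_eq_zero.1 (hzero _ (I.sub_mem (I.mul_mem_left x he) (hI e he x)) ?_)
    have : x * e - e * x = f * x - x * f := by rw [hfe]; noncomm_ring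
    rw [this]
    exact J.sub_mem (hJ f hf x) (J.mul_mem_left x hf)
  have hidem : e * e = e := by
    have : e * f = 0 := hzero _ (hI e he f) (J.mul_mem_left e hf)
    rw [hfe, mul_sub, mul_one, sub_eq_zero] at this
    exact this.symm
  obtain h0 | h1 := hR.2 e hidem (Semigroup.mem_center_iff.2 hcomm)
  · left
    rw [Submodule.eq_bot_iff]
    intro x hx
    refine hzero x hx ?_
    have : x = x * f := by rw [hfe, h0]; simp
    rw [this]
    exact J.mul_mem_left x hf
  · right
    rw [Submodule.eq_bot_iff]
    intro x hx
    refine hzero x ?_ hx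
    have : x = x * e := by rw [h1]; simp
    rw [this]
    exact I.mul_mem_left x he

/-- The trace in the regular module of the projectives satisfying `C`. -/
def traceIdeal {ι : Type} (P : ι → ModuleCat.{u} R) (C : ι → Prop) : Ideal R :=
  ⨆ (i : ι) (_ : C i) (f : P i →ₗ[R] R), LinearMap.range f

lemma traceIdeal_le {ι : Type} {P : ι → ModuleCat.{u} R} {C : ι → Prop} {I : Ideal R} :
    traceIdeal P C ≤ I ↔ ∀ i, C i → ∀ f : P i →ₗ[R] R, LinearMap.range f ≤ I := by
  simp only [traceIdeal, iSup_le_iff]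

lemma range_le_traceIdeal {ι : Type} (P : ι → ModuleCat.{u} R) {C : ι → Prop} {i : ι} (hi : C i)
    (f : P i →ₗ[R] R) : LinearMap.range f ≤ traceIdeal P C :=
  traceIdeal_le.1 le_rfl i hi f

lemma mul_mem_traceIdeal {ι : Type} (P : ι → ModuleCat.{u} R) {C : ι → Prop} {x : R}
    (hx : x ∈ traceIdeal P C) (r : R) : x * r ∈ traceIdeal P C := by
  have : traceIdeal P C ≤ Submodule.comap (LinearMap.toSpanSingleton R R r) (traceIdeal P C) := by
    rw [traceIdeal_le]
    rintro i hi f _ ⟨y, rfl⟩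
    exact range_le_traceIdeal P hi (LinearMap.toSpanSingleton R R r ∘ₗ f) ⟨y, rfl⟩
  exact this hx

variable [IsArtinianRing R]

namespace IsProjSystem
variable {ι : Type} {P : ι → ModuleCat.{u} R} (hP : IsProjSystem P)
include hP

/-- Otherwise the sum lies in a maximal left ideal `K`. The cover of `R ⧸ K` lifts to a map into `R`
whose image lies in the sum, hence in `K`: a contradiction. -/
lemma traceIdeal_sup {C D : ι → Prop} (h : ∀ i, C i ∨ D i) :
    traceIdeal P C ⊔ traceIdeal P D = ⊤ := by
  by_contra hne
  obtain ⟨K, hK, hle⟩ := (eq_top_or_exists_le_coatom (traceIdeal P C ⊔ traceIdeal P D)).resolve_left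
    hne
  have hs : IsSimpleModule R (R ⧸ K) := isSimpleModule_iff_isCoatom.2 hK
  obtain ⟨i, f, hf⟩ := hP.exists_cover_simple (R ⧸ K)
  have := (hP.isIndecProj i).projective
  obtain ⟨g, hg⟩ := Module.projective_lifting_property K.mkQ f K.mkQ_surjective
  have hgK : LinearMap.range g ≤ K := by
    obtain hi | hi := h i
    · exact (range_le_traceIdeal P hi g).trans (le_sup_left.trans hle)
    · exact (range_le_traceIdeal P hi g).trans (le_sup_right.trans hle)
  refine hf ?_
  rw [← hg, ← LinearMap.range_le_ker_iff, Submodule.ker_mkQ]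
  exact hgK

omit [IsArtinianRing R] in
lemma traceIdeal_ne_bot {C : ι → Prop} {i : ι} (hi : C i) : traceIdeal P C ≠ ⊥ := by
  have hfin := (hP.isIndecProj i).finite
  have hproj := (hP.isIndecProj i).projective
  have hnt := (hP.isIndecProj i).indecomposable.1
  obtain ⟨m, p, hp⟩ := Module.Finite.exists_fin' R (P i)
  obtain ⟨s, hs⟩ := Module.projective_lifting_property p LinearMap.id hp
  intro hbot
  obtain ⟨x, hx⟩ := exists_ne (0 : P i)
  refine hx ?_
  have hsx : s x = 0 := by
    ext a
    have := range_le_traceIdeal P hi (LinearMap.proj a ∘ₗ s) ⟨x, rfl⟩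
    rw [hbot] at this
    simpa using this
  have := LinearMap.congr_fun hs x
  rw [LinearMap.comp_apply, hsx, map_zero] at this
  exact this.symm

/-- A simple `T` in the intersection embeds in its own cover `P j`, and the embedding extends to `R
→ P j`. One of the two traces consists of images of projectives with no non-zero map to `P j`, so it
is killed, although `T` is not. -/
lemma traceIdeal_inf (hR : IsSymmNakayamaRing R) {C : ι → Prop}
    (h : ∀ i j, ∀ f : P i →ₗ[R] P j, f ≠ 0 → (C i ↔ C j)) :
    traceIdeal P C ⊓ traceIdeal P (fun i => ¬ C i) = ⊥ := by
  by_contra hne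
  obtain ⟨T, hT, hle⟩ := (eq_bot_or_exists_atom_le
    (traceIdeal P C ⊓ traceIdeal P (fun i => ¬ C i))).resolve_left hne
  have hs : IsSimpleModule R T := isSimpleModule_iff_isAtom.2 hT
  have := IsSimpleModule.nontrivial R T
  obtain ⟨j, f, hf⟩ := hP.exists_cover_simple T
  have hfin := (hP.isIndecProj j).finite
  have hproj := (hP.isIndecProj j).projective
  obtain ⟨e, he⟩ := hR.exists_simple_embedding (hP.isIndecProj j).indecomposable hf
  have := hR.injective_of_projective (P j)
  obtain ⟨g, hg⟩ := Module.Injective.out T.subtype T.injective_subtype e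
  have hvanish : ∀ D : ι → Prop, (∀ i, D i → ∀ f : P i →ₗ[R] P j, f = 0) →
      ¬ T ≤ traceIdeal P D := by
    intro D hD hTD
    have : traceIdeal P D ≤ LinearMap.ker g := by
      rw [traceIdeal_le]
      rintro i hi k
      rw [LinearMap.range_le_ker_iff]
      exact hD i hi _
    obtain ⟨x, hx⟩ := exists_ne (0 : T)
    refine hx (he ?_)
    rw [map_zero, ← hg x]
    exact this (hTD x.2)
  by_cases hC : C j
  · refine hvanish _ (fun i hi f => ?_) (hle.trans inf_le_right)
    by_contra hf
    exact hi ((h i j f hf).2 hC)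
  · refine hvanish _ (fun i hi f => ?_) (hle.trans inf_le_left)
    by_contra hf
    exact hC ((h i j f hf).1 hi)

lemma block (hR : IsSymmNakayamaRing R) (hind : IsRingIndecomposable R) {C : ι → Prop}
    (h : ∀ i j, ∀ f : P i →ₗ[R] P j, f ≠ 0 → (C i ↔ C j)) {i j : ι} (hi : C i) : C j := by
  by_contra hj
  obtain h' | h' := hind.eq_bot_or_eq_bot
    (I := traceIdeal P C) (J := traceIdeal P (fun i => ¬ C i))
    (IsCompl.of_eq (hP.traceIdeal_inf hR h) (hP.traceIdeal_sup fun i => em (C i)))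
    (fun x hx r => mul_mem_traceIdeal P hx r) (fun x hx r => mul_mem_traceIdeal P hx r)
  · exact hP.traceIdeal_ne_bot hi h'
  · exact hP.traceIdeal_ne_bot (C := fun i => ¬ C i) hj h'

section
variable (hR : IsSymmNakayamaRing R) (hind : IsRingIndecomposable R) {π : ι → ι}
    (hπ : ∀ i, (len R (P i) = 1 ∧ π i = i) ∨
    2 ≤ len R (P i) ∧ ∃ f : P (π i) →ₗ[R] P i, len R (LinearMap.range f) + 1 = len R (P i))
include hR hind hπ

/-- The quiver is a single cycle. -/
lemma exists_iterate_eq (i j : ι) : ∃ c, j = π^[c] i := by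
  have hper := hP.mem_periodicPts hR hπ
  refine hP.block hR hind (C := fun j => ∃ c, j = π^[c] i) (fun j k f hf => ?_) ⟨0, rfl⟩
  obtain ⟨c, hc⟩ := hP.eq_iterate_of_ne_zero hR hπ hf
  constructor
  · rintro ⟨e, he⟩
    obtain ⟨e', he'⟩ := Function.exists_iterate_eq_of_mem_periodicPts (hper k) hc
    exact ⟨e' + e, by rw [Function.iterate_add_apply, ← he, he']⟩
  · rintro ⟨e, he⟩
    exact ⟨c + e, by rw [Function.iterate_add_apply, ← he, hc]⟩

/-- Lengths do not decrease along arrows and the quiver is a cycle, so they are constant. -/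
lemma len_eq (i j : ι) : len R (P i) = len R (P j) := by
  have key : ∀ i j, len R (P i) ≤ len R (P j) := by
    intro i j
    obtain ⟨c, rfl⟩ := hP.exists_iterate_eq hR hind hπ i j
    induction c with
    | zero => exact le_rfl
    | succ c ih =>
      rw [Function.iterate_succ_apply']
      exact ih.trans (hP.len_le_len_next hR hπ _)
  exact le_antisymm (key i j) (key j i)

end

end IsProjSystem

/-! ### Loewy length -/

/-- The quotient by the radical is semisimple and uniserial, hence simple. -/
lemma IsUniserial.len_jacobson_smul {M : Type u} [AddCommGroup M] [Module R M] [Module.Finite R M]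
    [Nontrivial M] (hM : IsUniserial R M) :
    len R (Ring.jacobson R • (⊤ : Submodule R M) : Submodule R M) + 1 = len R M := by
  set N : Submodule R M := Ring.jacobson R • ⊤
  have hlt : N < ⊤ := Submodule.jacobson_smul_lt_top ⊤
  have htor : Module.IsTorsionBySet R (M ⧸ N) (Ring.jacobson R) := by
    rw [Module.isTorsionBySet_quotient_iff]
    exact fun m i hi => Submodule.smul_mem_smul hi trivial
  have hss : IsSemisimpleModule R (M ⧸ N) := by
    let _ := htor.module
    exact (htor.semilinearMap.isSemisimpleModule_iff_of_bijective Function.bijective_id).2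
      inferInstance
  have hnt : Nontrivial (M ⧸ N) := Submodule.Quotient.nontrivial_iff.2 hlt.ne
  have hsimple : IsSimpleModule R (M ⧸ N) := by
    obtain ⟨K, hK⟩ := exists_simple_submodule (R := R) (M ⧸ N)
    obtain ⟨L, hL⟩ := exists_isCompl K
    obtain h | h := (hM.quotient N).indecomposable.2 K L hL
    · exact absurd h (isSimpleModule_iff_isAtom.1 hK).1
    · have hKt : K = ⊤ := by simpa [h] using hL.sup_eq_top
      rw [← len_eq_one_iff, ← len_top, ← hKt, len_eq_one_iff]
      exact hK
  rw [← len_submodule_add N, len_eq_one_iff.2 hsimple]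

lemma IsUniserial.len_jacobson_pow_smul {M : Type u} [AddCommGroup M] [Module R M]
    [Module.Finite R M] (hM : IsUniserial R M) (m : ℕ) :
    len R (Ring.jacobson R ^ m • (⊤ : Submodule R M) : Submodule R M) = len R M - m := by
  induction m generalizing M with
  | zero => rw [Submodule.pow_zero, Ideal.one_eq_top, Submodule.top_smul, len_top]; rfl
  | succ m ih =>
    set N : Submodule R M := Ring.jacobson R • ⊤ with hN
    have h : Ring.jacobson R ^ (m + 1) • (⊤ : Submodule R M) =
        (Ring.jacobson R ^ m • (⊤ : Submodule R N)).map N.subtype := by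
      rw [Submodule.map_smul'', Submodule.map_top, Submodule.range_subtype, Submodule.pow_succ,
        Submodule.mul_smul]
    rw [h, ← len_congr (Submodule.equivMapOfInjective _ N.injective_subtype _),
      ih (hM.submodule N)]
    obtain hM' | hM' := subsingleton_or_nontrivial M
    · have h1 := len_eq_zero_iff (R := R).2 hM'
      have h2 := len_submodule_le N
      omega
    · have := hM.len_jacobson_smul
      rw [← hN] at this
      omega

lemma IsProjSystem.jacobson_pow_eq_bot_iff {ι : Type} {P : ι → ModuleCat.{u} R}
    (hP : IsProjSystem P) (hR : IsSymmNakayamaRing R) (m : ℕ) :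
    Ring.jacobson R ^ m = ⊥ ↔ ∀ i, len R (P i) ≤ m := by
  constructor
  · intro h i
    have := (hP.isIndecProj i).finite
    have h1 := (hR.indecProj_uniserial (hP.isIndecProj i)).len_jacobson_pow_smul m
    rw [h, Submodule.bot_smul] at h1
    have h2 : len R (⊥ : Submodule R (P i)) = 0 := len_eq_zero_iff.2 inferInstance
    omega
  · intro h
    -- The right annihilator of the power of the radical contains the image of every `P i → R`;
    -- these images span `R`, so it contains `1`.
    let K : Ideal R :=
      { carrier := {x | ∀ s ∈ Ring.jacobson R ^ m, s * x = 0}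
        add_mem' := fun hx hy s hs => by rw [mul_add, hx s hs, hy s hs, add_zero]
        zero_mem' := fun s _ => mul_zero s
        smul_mem' := fun r x hx s hs => by
          rw [smul_eq_mul, ← mul_assoc]
          exact hx _ (Ideal.mul_mem_right r _ hs) }
    have hle : traceIdeal P (fun _ => True) ≤ K := by
      rw [traceIdeal_le]
      rintro i - f _ ⟨x, rfl⟩ s hs
      have := (hP.isIndecProj i).finite
      have h1 := (hR.indecProj_uniserial (hP.isIndecProj i)).len_jacobson_pow_smul m
      have h2 : (Ring.jacobson R ^ m • ⊤ : Submodule R (P i)) = ⊥ :=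
        eq_bot_of_len_eq_zero (by have := h i; omega)
      have h3 : s • x ∈ (Ring.jacobson R ^ m • ⊤ : Submodule R (P i)) :=
        Submodule.smul_mem_smul hs trivial
      rw [h2, Submodule.mem_bot] at h3
      rw [← smul_eq_mul, ← map_smul, h3, map_zero]
    rw [Submodule.eq_bot_iff]
    intro s hs
    have h1 : (1 : R) ∈ K := by
      refine hle ?_
      rw [← sup_idem (traceIdeal P (fun _ => True)), hP.traceIdeal_sup fun _ => .inl trivial]
      trivial
    simpa using h1 s hs

end

/-! ### The Jacobson radical of the opposite ring -/

section
variable {B : Type u} [Ring B]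

lemma isNilpotent_of_mem {I : Ideal B} (hI : IsNilpotent I) {x : B} (hx : x ∈ I) :
    IsNilpotent x := by
  obtain ⟨m, hm⟩ := hI
  have key : ∀ m, x ^ m ∈ I ^ m := by
    intro m
    induction m with
    | zero => rw [Submodule.pow_zero, Ideal.one_eq_top]; trivial
    | succ m ih => rw [pow_succ, Submodule.pow_succ]; exact Ideal.mul_mem_mul ih hx
  exact ⟨m, by simpa [hm] using key m⟩

lemma op_mem_jacobson_of_mem (h : IsNilpotent (Ring.jacobson B)) {b : B}
    (hb : b ∈ Ring.jacobson B) : MulOpposite.op b ∈ Ring.jacobson Bᵐᵒᵖ := by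
  rw [Ring.jacobson_eq_sInf_isMaximal, Ideal.mem_sInf]
  intro m hm
  by_contra hbm
  obtain ⟨r, y, hy, hry⟩ := Ideal.IsMaximal.exists_inv hm hbm
  have hu : IsUnit (1 - r * MulOpposite.op b) := by
    refine IsNilpotent.isUnit_one_sub ?_
    have : r * MulOpposite.op b = MulOpposite.op (b * r.unop) := by simp
    rw [this]
    obtain ⟨N, hN⟩ := isNilpotent_of_mem h (Ideal.mul_mem_right r.unop _ hb)
    exact ⟨N, by rw [← MulOpposite.op_pow, hN, MulOpposite.op_zero]⟩
  rw [← hry, add_sub_cancel_left] at hu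
  exact hm.ne_top (Ideal.eq_top_of_isUnit_mem _ hy hu)

lemma mem_jacobson_of_op_mem (h : IsNilpotent (Ring.jacobson Bᵐᵒᵖ)) {b : B}
    (hb : MulOpposite.op b ∈ Ring.jacobson Bᵐᵒᵖ) : b ∈ Ring.jacobson B := by
  rw [Ring.jacobson_eq_sInf_isMaximal, Ideal.mem_sInf]
  intro m hm
  by_contra hbm
  obtain ⟨r, y, hy, hry⟩ := Ideal.IsMaximal.exists_inv hm hbm
  have hu : IsUnit (1 - r * b) := by
    refine IsNilpotent.isUnit_one_sub ?_
    obtain ⟨N, hN⟩ := isNilpotent_of_mem h (Ideal.mul_mem_right (MulOpposite.op r) _ hb)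
    refine ⟨N, ?_⟩
    rwa [← MulOpposite.op_mul, ← MulOpposite.op_pow, MulOpposite.op_eq_zero_iff] at hN
  rw [← hry, add_sub_cancel_left] at hu
  exact hm.ne_top (Ideal.eq_top_of_isUnit_mem _ hy hu)

lemma op_mem_jacobson_pow_iff (h1 : IsNilpotent (Ring.jacobson B))
    (h2 : IsNilpotent (Ring.jacobson Bᵐᵒᵖ)) (m : ℕ) (b : B) :
    MulOpposite.op b ∈ Ring.jacobson Bᵐᵒᵖ ^ m ↔ b ∈ Ring.jacobson B ^ m := by
  have key : ∀ b : B, MulOpposite.op b ∈ Ring.jacobson Bᵐᵒᵖ ↔ b ∈ Ring.jacobson B :=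
    fun b => ⟨mem_jacobson_of_op_mem h2, op_mem_jacobson_of_mem h1⟩
  induction m generalizing b with
  | zero => simp [Submodule.pow_zero, Ideal.one_eq_top]
  | succ m ih =>
    -- Passing to the opposite ring reverses products, so one side splits off the last factor and
    -- the other the first; the latter needs a non-zero exponent.
    obtain rfl | hm := eq_or_ne m 0
    · simpa [Submodule.pow_succ, Submodule.pow_zero, Ideal.one_eq_top] using key b
    constructor
    · rw [Submodule.pow_succ, Submodule.pow_succ' _ hm]
      intro hb
      suffices ∀ x ∈ Ring.jacobson Bᵐᵒᵖ ^ m * Ring.jacobson Bᵐᵒᵖ,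
          x.unop ∈ Ring.jacobson B * Ring.jacobson B ^ m from this _ hb
      intro x hx
      induction hx using Submodule.mul_induction_on' with
      | mem_mul_mem x hx y hy =>
        rw [MulOpposite.unop_mul]
        exact Ideal.mul_mem_mul ((key _).1 hy) ((ih _).1 hx)
      | add x _ y _ hx hy => exact Ideal.add_mem _ hx hy
    · rw [Submodule.pow_succ, Submodule.pow_succ' _ hm]
      intro hb
      induction hb using Submodule.mul_induction_on' with
      | mem_mul_mem x hx y hy =>
        rw [MulOpposite.op_mul]
        exact Ideal.mul_mem_mul ((key _).2 hy) ((ih _).2 hx)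
      | add x _ y _ hx hy => exact Ideal.add_mem _ hx hy

lemma hasLoewyLength_mulOpposite {l : ℕ} (h1 : IsNilpotent (Ring.jacobson B))
    (h2 : IsNilpotent (Ring.jacobson Bᵐᵒᵖ)) (h : HasLoewyLength B l) :
    HasLoewyLength Bᵐᵒᵖ l := by
  have : {m : ℕ | Ring.jacobson Bᵐᵒᵖ ^ m = ⊥} = {m : ℕ | Ring.jacobson B ^ m = ⊥} := by
    ext m
    simp only [Set.mem_ofPred_eq, Submodule.eq_bot_iff]
    constructor
    · intro h b hb
      simpa using h _ ((op_mem_jacobson_pow_iff h1 h2 m b).2 hb)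
    · intro h b hb
      simpa using h b.unop ((op_mem_jacobson_pow_iff h1 h2 m b.unop).1 (by simpa using hb))
  rwa [HasLoewyLength, this]

end

/-! ### Cyclic systems of projectives -/

/-- Indecomposable projectives of length `l` whose quiver is an oriented cycle of length `n`. -/
structure IsNakayamaSystem {R : Type u} [Ring R] (n l : ℕ) (P : ZMod n → ModuleCat.{u} R) : Prop
    extends IsProjSystem P where
  len_eq : ∀ i, len R (P i) = l
  step : ∀ i, ∃ f : P (i + 1) →ₗ[R] P i, len R (LinearMap.range f) + 1 = l

lemma minimalPeriod_eq {n : ℕ} {π : Fin n → Fin n} {i : Fin n} (hper : i ∈ Function.periodicPts π)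
    (h : ∀ j, ∃ c, j = π^[c] i) : Function.minimalPeriod π i = n := by
  have hpos := Function.minimalPeriod_pos_of_mem_periodicPts hper
  let f : Fin (Function.minimalPeriod π i) → Fin n := fun c => π^[c] i
  have hinj : Function.Injective f := fun c c' hcc =>
    Fin.ext (Function.iterate_injOn_Iio_minimalPeriod c.2 c'.2 hcc)
  have hsurj : Function.Surjective f := fun j => by
    obtain ⟨c, rfl⟩ := h j
    exact ⟨⟨c % Function.minimalPeriod π i, Nat.mod_lt _ hpos⟩,
      Function.iterate_mod_minimalPeriod_eq⟩
  simpa using Fintype.card_of_bijective ⟨hinj, hsurj⟩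

theorem IsSymmNakayamaRing.exists_isNakayamaSystem {R : Type u} [Ring R] [IsArtinianRing R]
    (hR : IsSymmNakayamaRing R) (hind : IsRingIndecomposable R) {n l : ℕ} (hn : 1 ≤ n)
    (hl : 2 ≤ l)
    {P : Fin n → ModuleCat.{u} R} (hP : IsProjSystem P) (hLL : HasLoewyLength R l) :
    ∃ Q : ZMod n → ModuleCat.{u} R, IsNakayamaSystem n l Q := by
  let i₀ : Fin n := ⟨0, hn⟩
  have : NeZero n := ⟨by omega⟩
  obtain ⟨π, hπ⟩ := hP.exists_next hR
  have hlen : ∀ i, len R (P i) = l := by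
    intro i
    have h1 : len R (P i) ≤ l := (hP.jacobson_pow_eq_bot_iff hR l).1 hLL.1 i
    have h2 : l ≤ len R (P i) := hLL.2 ((hP.jacobson_pow_eq_bot_iff hR _).2 fun j =>
      (hP.len_eq hR hind hπ j i).le)
    omega
  have hcyc := hP.exists_iterate_eq hR hind hπ i₀
  have hmin := minimalPeriod_eq (hP.mem_periodicPts hR hπ i₀) hcyc
  have hperiod : Function.IsPeriodicPt π n i₀ := by
    have := Function.isPeriodicPt_minimalPeriod π i₀
    rwa [hmin] at this
  -- Vertices are numbered along the cycle from `i₀`; the exact period `n` makes this well behaved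
  -- on `ZMod n`.
  refine ⟨fun z => P (π^[z.val] i₀), ⟨⟨fun _ => hP.isIndecProj _, fun z w h => ?_,
    fun Q _ _ hQ => ?_⟩, fun _ => hlen _, fun z => ?_⟩⟩
  · have := hP.eq_of_equiv _ _ h
    refine ZMod.val_injective n (Function.iterate_injOn_Iio_minimalPeriod (f := π) (x := i₀)
      ?_ ?_ this)
    · rw [hmin]; exact ZMod.val_lt z
    · rw [hmin]; exact ZMod.val_lt w
  · obtain ⟨j, hj⟩ := hP.exists_equiv Q hQ
    obtain ⟨c, rfl⟩ := hcyc j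
    refine ⟨c, ?_⟩
    rwa [ZMod.val_natCast, hperiod.iterate_mod_apply]
  · have : π^[(z + 1).val] i₀ = π (π^[z.val] i₀) := by
      rw [← Function.iterate_succ_apply' π, ← hperiod.iterate_mod_apply (z.val + 1),
        ZMod.val_add, ZMod.val_one_eq_one_mod, Nat.add_mod_mod]
    rw [this]
    obtain ⟨h, -⟩ | ⟨-, f, hf⟩ := hπ (π^[z.val] i₀)
    · rw [hlen] at h; omega
    · exact ⟨f, by rw [hf, hlen]⟩

/-! ### Uniserial modules by top and length -/

/-- `M` has length `x.2` and its projective cover is `P x.1`. -/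
structure IsOfType {R : Type u} [Ring R] {n : ℕ} (P : ZMod n → ModuleCat.{u} R) (x : ZMod n × ℕ)
    (M : Type u) [AddCommGroup M] [Module R M] : Prop where
  exists_surjective : ∃ f : P x.1 →ₗ[R] M, Function.Surjective f
  len_eq : len R M = x.2
  pos : 1 ≤ x.2

namespace IsNakayamaSystem
variable {R : Type u} [Ring R] [IsArtinianRing R] {n l : ℕ} {P : ZMod n → ModuleCat.{u} R}
  (hP : IsNakayamaSystem n l P) (hR : IsSymmNakayamaRing R)
  {M N : Type u} [AddCommGroup M] [Module R M] [AddCommGroup N] [Module R N]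
include hP

omit [IsArtinianRing R] in
lemma finite_of_type {x : ZMod n × ℕ} (h : IsOfType P x M) : Module.Finite R M := by
  have := (hP.isIndecProj x.1).finite
  obtain ⟨f, hf⟩ := h.exists_surjective
  exact Module.Finite.of_surjective f hf

lemma nontrivial_of_type {x : ZMod n × ℕ} (h : IsOfType P x M) : Nontrivial M := by
  have := hP.finite_of_type h
  rw [← len_pos_iff (R := R), h.len_eq]
  exact h.pos

lemma le_of_type {x : ZMod n × ℕ} (h : IsOfType P x M) : x.2 ≤ l := by
  have := (hP.isIndecProj x.1).finite
  obtain ⟨f, hf⟩ := h.exists_surjective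
  rw [← h.len_eq, ← hP.len_eq x.1]
  exact len_le_of_surjective hf

lemma isOfType_of_surjective {x : ZMod n × ℕ} (h : IsOfType P x M) [Nontrivial N]
    {f : M →ₗ[R] N} (hf : Function.Surjective f) : IsOfType P (x.1, len R N) N := by
  have := hP.finite_of_type h
  have : Module.Finite R N := Module.Finite.of_surjective f hf
  obtain ⟨g, hg⟩ := h.exists_surjective
  exact ⟨⟨f ∘ₗ g, hf.comp hg⟩, rfl, len_pos_iff.2 inferInstance⟩

lemma isOfType_proj (i : ZMod n) : IsOfType P (i, l) (P i) := by
  refine ⟨⟨LinearMap.id, Function.surjective_id⟩, hP.len_eq i, ?_⟩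
  rw [← hP.len_eq i]
  exact hP.one_le_len i

lemma exists_isOfType {x : ZMod n × ℕ} (h1 : 1 ≤ x.2) (h2 : x.2 ≤ l) :
    ∃ X : ModuleCat.{u} R, IsOfType P x X := by
  have := (hP.isIndecProj x.1).finite
  obtain ⟨K, hK⟩ := exists_submodule_len (R := R) (P x.1) (c := l - x.2)
    (by rw [hP.len_eq]; omega)
  have h := len_submodule_add K
  rw [hP.len_eq] at h
  exact ⟨ModuleCat.of R (P x.1 ⧸ K), ⟨K.mkQ, K.mkQ_surjective⟩,
    show len R (P x.1 ⧸ K) = _ by omega, h1⟩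

lemma projective_of_type {x : ZMod n × ℕ} (h : IsOfType P x M) (hx : x.2 = l) :
    Module.Projective R M := by
  have := (hP.isIndecProj x.1).finite
  have := (hP.isIndecProj x.1).projective
  obtain ⟨f, hf⟩ := h.exists_surjective
  exact Module.Projective.of_equiv (LinearEquiv.ofBijective f
    ⟨injective_of_surjective_of_len_le hf (by rw [hP.len_eq, h.len_eq, hx]), hf⟩)

include hR

omit [IsArtinianRing R] in
lemma uniserial_of_type {x : ZMod n × ℕ} (h : IsOfType P x M) : IsUniserial R M := by
  obtain ⟨f, hf⟩ := h.exists_surjective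
  exact (hR.indecProj_uniserial (hP.isIndecProj x.1)).of_surjective hf

lemma exists_type_of_indecomposable [Module.Finite R M] (hM : IsIndecomposableModule R M) :
    ∃ x, IsOfType P x M := by
  have := hM.1
  obtain ⟨i, f, hf⟩ := hP.exists_cover (hR.uniserial_of_indecomposable hM)
  exact ⟨(i, len R M), ⟨f, hf⟩, rfl, len_pos_iff.2 inferInstance⟩

lemma type_unique {x y : ZMod n × ℕ} (hx : IsOfType P x M) (hy : IsOfType P y M) : x = y := by
  have := hP.nontrivial_of_type hx
  obtain ⟨f, hf⟩ := hx.exists_surjective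
  obtain ⟨g, hg⟩ := hy.exists_surjective
  refine Prod.ext (hP.eq_of_equiv _ _ ?_) (hx.len_eq.symm.trans hy.len_eq)
  exact hR.equiv_of_surjective (hP.isIndecProj _) (hP.isIndecProj _) hf hg

lemma equiv_of_type {x : ZMod n × ℕ} (hM : IsOfType P x M) (hN : IsOfType P x N) :
    Nonempty (M ≃ₗ[R] N) := by
  have := (hP.isIndecProj x.1).finite
  obtain ⟨f, hf⟩ := hM.exists_surjective
  obtain ⟨g, hg⟩ := hN.exists_surjective
  exact (hR.indecProj_uniserial (hP.isIndecProj x.1)).quotient_equiv hf hg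
    (hM.len_eq.trans hN.len_eq.symm)

lemma exists_radical_map (hl : 2 ≤ l) (i : ZMod n) {c : ℕ} (hc : c < l) :
    ∃ f : P (i + c) →ₗ[R] P i, len R (LinearMap.range f) + c = l := by
  have key := hP.toIsProjSystem.exists_iterate hR (π := (· + 1)) (fun i => .inr
    ⟨by rw [hP.len_eq]; exact hl, by rw [hP.len_eq]; exact hP.step i⟩) i (c := c)
    (by rwa [hP.len_eq])
  have h : (· + 1)^[c] i = i + c := by simp
  rwa [h, hP.len_eq] at key

/-- A submodule is the image of a radical layer of the projective cover, so its top is advanced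
along the cycle by its colength. -/
lemma isOfType_submodule (hl : 2 ≤ l) {x : ZMod n × ℕ} (h : IsOfType P x M) (K : Submodule R M)
    (hK : K ≠ ⊥) : IsOfType P (x.1 + (x.2 - len R K : ℕ), len R K) K := by
  have := hP.finite_of_type h
  have := (hP.isIndecProj x.1).finite
  have := (hP.isIndecProj (x.1 + (x.2 - len R K : ℕ))).finite
  have hpos := len_pos_of_ne_bot hK
  have hle := len_submodule_le K
  have hxl := hP.le_of_type h
  rw [h.len_eq] at hle
  obtain ⟨q, hq⟩ := h.exists_surjective
  obtain ⟨f, hf⟩ := hP.exists_radical_map hR hl x.1 (c := x.2 - len R K) (by omega)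
  have h1 := len_ker_add hq
  rw [hP.len_eq, h.len_eq] at h1
  have h2 := len_map_add_len_ker q (K := LinearMap.range f)
    ((hR.indecProj_uniserial (hP.isIndecProj x.1)).le_of_len_le (by omega))
  have h3 : LinearMap.range (q ∘ₗ f) = K := by
    rw [LinearMap.range_comp]
    exact (hP.uniserial_of_type hR h).eq_of_len_eq (by omega)
  refine ⟨⟨(LinearEquiv.ofEq _ _ h3).toLinearMap ∘ₗ (q ∘ₗ f).rangeRestrict,
    (LinearEquiv.ofEq _ _ h3).surjective.comp (q ∘ₗ f).surjective_rangeRestrict⟩, rfl, hpos⟩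

/-- The image of an extension of a non-zero map from a syzygy. -/
lemma len_range_extension {x : ZMod n × ℕ} (h : IsOfType P x M) {f : P x.1 →ₗ[R] M}
    (hf : Function.Surjective f) {k : P x.1 →ₗ[R] N} (hk : k ∘ₗ (LinearMap.ker f).subtype ≠ 0) :
    len R (LinearMap.range k) =
      len R (LinearMap.range (k ∘ₗ (LinearMap.ker f).subtype)) + x.2 := by
  have := (hP.isIndecProj x.1).finite
  -- The kernels are comparable, and `ker f ≤ ker k` would kill the restriction; so restricting `k`
  -- to `ker f` does not change its kernel.
  have hle : LinearMap.ker k ≤ LinearMap.ker f := by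
    refine (hR.indecProj_uniserial (hP.isIndecProj x.1) _ _).resolve_right fun hle => hk ?_
    ext z
    exact hle z.2
  have h1 := len_ker_add_range k
  have h2 := len_ker_add_range (k ∘ₗ (LinearMap.ker f).subtype)
  rw [LinearMap.ker_comp, len_congr (Submodule.comapSubtypeEquivOfLe hle)] at h2
  have h3 := len_ker_add hf
  rw [h.len_eq] at h3
  omega

end IsNakayamaSystem

/-! ### Extension groups between uniserial modules -/

namespace IsNakayamaSystem
variable {R : Type u} [Ring R] [IsArtinianRing R] {a n : ℕ} {P : ZMod n → ModuleCat.{u} R}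
  (hP : IsNakayamaSystem n (a * n + 1) P) (hR : IsSymmNakayamaRing R) (han : 1 ≤ a * n)
  {X Y : Type u} [AddCommGroup X] [Module R X] [AddCommGroup Y] [Module R Y]
include hP hR han

lemma isOfType_syz {x : ZMod n × ℕ} (hX : IsOfType P x X) (hx : x.2 ≤ a * n)
    {f : P x.1 →ₗ[R] X} (hf : Function.Surjective f) :
    IsOfType P (syz a x) (LinearMap.ker f) := by
  have := (hP.isIndecProj x.1).finite
  have h1 := len_ker_add hf
  rw [hX.len_eq, hP.len_eq] at h1
  have hker : LinearMap.ker f ≠ ⊥ := by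
    intro h
    rw [h, len_eq_zero_iff.2 inferInstance] at h1
    omega
  have := hP.isOfType_submodule hR (by omega) (hP.isOfType_proj x.1) _ hker
  convert this using 1
  simp only [syz, Prod.mk.injEq]
  exact ⟨by congr; omega, by omega⟩

open Abelian

lemma subsingleton_ext_one_iff {x y : ZMod n × ℕ} (hX : IsOfType P x X) (hY : IsOfType P y Y)
    (hx : x.2 ≤ a * n) :
    Subsingleton (Ext (ModuleCat.of R X) (ModuleCat.of R Y) 1) ↔ ¬ StHom a (syz a x) y := by
  have hfin := (hP.isIndecProj x.1).finite
  have hproj := (hP.isIndecProj x.1).projective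
  have hfinY := hP.finite_of_type hY
  have hYu := hP.uniserial_of_type hR hY
  have hYn := hP.nontrivial_of_type hY
  obtain ⟨f, hf⟩ := hX.exists_surjective
  have hK := hP.isOfType_syz hR han hX hx hf
  have hKu := hP.uniserial_of_type hR hK
  have hlK : len R (LinearMap.ker f) = a * n + 1 - x.2 := hK.len_eq
  rw [NakayamaCT.subsingleton_ext_one_iff hf]
  constructor
  · rintro h ⟨c, hc1, hc2, hc3, hc4, hc5⟩
    simp only [syz] at hc1 hc4 hc5
    obtain ⟨C, hC⟩ := exists_submodule_len (R := R) Y (c := c) (by rw [hY.len_eq]; exact hc3)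
    obtain ⟨D, hD⟩ := exists_submodule_len (R := R) (LinearMap.ker f) (c := a * n + 1 - x.2 - c)
      (by omega)
    have hCn : C ≠ ⊥ := by
      rintro rfl
      rw [len_eq_zero_iff.2 inferInstance] at hC
      omega
    have hlD := len_submodule_add D
    have hDc : len R (LinearMap.ker f ⧸ D) = c := by omega
    have hDn : Nontrivial (LinearMap.ker f ⧸ D) := by rw [← len_pos_iff (R := R)]; omega
    have t1 := hP.isOfType_submodule hR (by omega) hY C hCn
    have t2 := hP.isOfType_of_surjective hK D.mkQ_surjective
    rw [hDc] at t2
    rw [hC] at t1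
    have heq : y.1 + ((y.2 - c : ℕ) : ZMod n) = (syz a x).1 := by
      rw [Nat.cast_sub hc3, syz]
      linear_combination -hc5
    rw [heq] at t1
    obtain ⟨e⟩ := hP.equiv_of_type hR t2 t1
    -- The length-`c` quotient of the syzygy is identified with the length-`c` submodule of `Y`. An
    -- extension of this map to `P x.1` would have image of length `c + x.2`, too long for `Y`.
    obtain ⟨k, hk⟩ := h (C.subtype ∘ₗ e.toLinearMap ∘ₗ D.mkQ)
    have hrange : len R (LinearMap.range (C.subtype ∘ₗ e.toLinearMap ∘ₗ D.mkQ)) = c := by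
      rw [LinearMap.range_comp_of_range_eq_top, Submodule.range_subtype, hC]
      exact LinearMap.range_eq_top.2 (e.surjective.comp D.mkQ_surjective)
    rw [← hk] at hrange
    have hne : k ∘ₗ (LinearMap.ker f).subtype ≠ 0 := by
      intro h0
      rw [h0, LinearMap.range_zero, len_eq_zero_iff.2 inferInstance] at hrange
      omega
    have h1 := hP.len_range_extension hR hX hf hne
    have h2 := len_submodule_le (LinearMap.range k)
    rw [hY.len_eq] at h2
    omega
  · intro h g
    by_cases hg : g = 0
    · exact ⟨0, by rw [hg, LinearMap.zero_comp]⟩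
    obtain ⟨T, hT⟩ := exists_simple_submodule (R := R) Y
    obtain ⟨j, f', hf'⟩ := hP.exists_cover_simple T
    have hfinj := (hP.isIndecProj j).finite
    have hprojj := (hP.isIndecProj j).projective
    obtain ⟨e, he⟩ := hR.exists_hull hYu (hP.isIndecProj j).indecomposable hf'
    have := hR.injective_of_projective (P j)
    -- Extend first into the injective hull `P j` of `Y`. The image has length at most that of `Y`,
    -- so in the uniserial `P j` it lies inside `Y`, and the extension factors through `Y`.
    obtain ⟨k, hk⟩ := Module.Injective.out (LinearMap.ker f).subtype
      (LinearMap.ker f).injective_subtype (e ∘ₗ g)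
    have hke : k ∘ₗ (LinearMap.ker f).subtype = e ∘ₗ g := LinearMap.ext hk
    have hrg : LinearMap.range g ≠ ⊥ := by rwa [ne_eq, LinearMap.range_eq_bot]
    have hpos := len_pos_of_ne_bot hrg
    have : Nontrivial (LinearMap.range g) := len_pos_iff.1 hpos
    have t1 := hP.isOfType_submodule hR (by omega) hY _ hrg
    have t2 := hP.isOfType_of_surjective hK g.surjective_rangeRestrict
    have heq := congrArg Prod.fst (hP.type_unique hR t1 t2)
    simp only at heq
    have hle1 := len_submodule_le (LinearMap.range g)
    rw [hY.len_eq] at hle1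
    have hle2 := len_le_of_surjective g.surjective_rangeRestrict
    rw [hlK] at hle2
    have hcond : len R (LinearMap.range g) + x.2 ≤ y.2 := by
      by_contra hlt
      refine h ⟨len R (LinearMap.range g), by simp only [syz]; omega, hpos, hle1,
        by simp only [syz]; omega, ?_⟩
      rw [Nat.cast_sub hle1] at heq
      linear_combination -heq
    have hne : k ∘ₗ (LinearMap.ker f).subtype ≠ 0 := by
      rw [hke]
      intro h0
      refine hg (LinearMap.ext fun z => he ?_)
      simpa using LinearMap.congr_fun h0 z
    have h1 := hP.len_range_extension hR hX hf hne
    rw [hke, LinearMap.range_comp, ← len_congr (Submodule.equivMapOfInjective e he _)] at h1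
    have hle : LinearMap.range k ≤ LinearMap.range e :=
      (hR.indecProj_uniserial (hP.isIndecProj j)).le_of_len_le
        (by rw [len_range_of_injective he, hY.len_eq]; omega)
    refine ⟨(LinearEquiv.ofInjective e he).symm.toLinearMap ∘ₗ
      k.codRestrict (LinearMap.range e) (fun z => hle ⟨z, rfl⟩), LinearMap.ext fun z => ?_⟩
    apply (LinearEquiv.ofInjective e he).injective
    ext
    simpa using hk z

theorem subsingleton_ext_iff {x y : ZMod n × ℕ} (hX : IsOfType P x X) (hY : IsOfType P y Y)
    (hx : x.2 ≤ a * n) {r : ℕ} (hr : 1 ≤ r) :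
    Subsingleton (Ext (ModuleCat.of R X) (ModuleCat.of R Y) r) ↔ ¬ StHom a ((syz a)^[r] x) y := by
  obtain ⟨r, rfl⟩ := Nat.exists_eq_add_of_le' hr
  induction r generalizing x X with
  | zero => exact hP.subsingleton_ext_one_iff hR han hX hY hx
  | succ r ih =>
    have hproj := (hP.isIndecProj x.1).projective
    obtain ⟨f, hf⟩ := hX.exists_surjective
    rw [subsingleton_ext_succ_iff hf, ih (hP.isOfType_syz hR han hX hx hf)
      (syz_valid hX.pos hx).2 (by omega), ← Function.iterate_succ_apply]

end IsNakayamaSystem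

/-! ### Additive closures -/

section AddClosure
variable {R : Type u} [Ring R] {M : ModuleCat.{u} R}

lemma addClosure_of_retract {X Y : ModuleCat.{u} R} (hX : addClosure R M X) (s : Y →ₗ[R] X)
    (p : X →ₗ[R] Y) (h : p ∘ₗ s = LinearMap.id) : addClosure R M Y := by
  obtain ⟨r, s', p', h'⟩ := hX
  refine ⟨r, s' ∘ₗ s, p ∘ₗ p', LinearMap.ext fun y => ?_⟩
  have h1 := LinearMap.congr_fun h' (s y)
  have h2 := LinearMap.congr_fun h y
  simp only [LinearMap.comp_apply, LinearMap.id_apply] at h1 h2 ⊢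
  rw [h1, h2]

lemma addClosure_of_equiv {X Y : ModuleCat.{u} R} (hX : addClosure R M X) (e : X ≃ₗ[R] Y) :
    addClosure R M Y :=
  addClosure_of_retract hX e.symm.toLinearMap e.toLinearMap (by ext; simp)

lemma addClosure_of_summand {X : ModuleCat.{u} R} (s : X →ₗ[R] M) (p : M →ₗ[R] X)
    (h : p ∘ₗ s = LinearMap.id) : addClosure R M X := by
  refine ⟨1, LinearMap.pi fun _ => s, p ∘ₗ LinearMap.proj 0, ?_⟩
  rw [← h]
  rfl

lemma addClosure_submodule {X : Type u} [AddCommGroup X] [Module R X]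
    (hX : addClosure R M (ModuleCat.of R X)) {K L : Submodule R X} (h : IsCompl K L) :
    addClosure R M (ModuleCat.of R K) :=
  addClosure_of_retract (Y := ModuleCat.of R K) hX K.subtype (K.projectionOnto L h)
    (by ext x; simp)

lemma addClosure_of_isCompl {X : Type u} [AddCommGroup X] [Module R X] {K L : Submodule R X}
    (h : IsCompl K L) (hK : addClosure R M (ModuleCat.of R K))
    (hL : addClosure R M (ModuleCat.of R L)) : addClosure R M (ModuleCat.of R X) := by
  obtain ⟨r, s, p, hps⟩ := hK
  obtain ⟨r', s', p', hps'⟩ := hL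
  let e : ((Fin r ⊕ Fin r') → M) ≃ₗ[R] (Fin (r + r') → M) :=
    LinearEquiv.funCongrLeft R M finSumFinEquiv.symm
  let e' := LinearEquiv.sumArrowLequivProdArrow (Fin r) (Fin r') R M
  refine ⟨r + r', (e.toLinearMap ∘ₗ e'.symm.toLinearMap) ∘ₗ (LinearMap.prodMap s s') ∘ₗ
    (K.prodEquivOfIsCompl L h).symm.toLinearMap, (K.prodEquivOfIsCompl L h).toLinearMap ∘ₗ
    (LinearMap.prodMap p p') ∘ₗ (e'.toLinearMap ∘ₗ e.symm.toLinearMap), ?_⟩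
  refine LinearMap.ext fun x => ?_
  have h1 := fun z => LinearMap.congr_fun hps z
  have h2 := fun z => LinearMap.congr_fun hps' z
  simp only [LinearMap.comp_apply, LinearMap.id_apply] at h1 h2
  obtain ⟨y, rfl⟩ := (K.prodEquivOfIsCompl L h).surjective x
  obtain ⟨y1, y2⟩ := y
  simp only [LinearMap.comp_apply, LinearEquiv.coe_coe, LinearEquiv.symm_apply_apply,
    LinearEquiv.apply_symm_apply, LinearMap.prodMap_apply, LinearMap.id_apply]
  rw [h1, h2]

lemma addClosure_projective (s : R →ₗ[R] M) (p : M →ₗ[R] R)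
    (h : p ∘ₗ s = LinearMap.id) {X : ModuleCat.{u} R} [Module.Finite R X] [Module.Projective R X] :
    addClosure R M X := by
  obtain ⟨r, q, hq⟩ := Module.Finite.exists_fin' R X
  obtain ⟨t, ht⟩ := Module.projective_lifting_property q LinearMap.id hq
  refine ⟨r, s.compLeft (Fin r) ∘ₗ t, q ∘ₗ p.compLeft (Fin r), LinearMap.ext fun x => ?_⟩
  have h1 : p.compLeft (Fin r) (s.compLeft (Fin r) (t x)) = t x := by
    ext a
    exact LinearMap.congr_fun h (t x a)
  simp only [LinearMap.comp_apply, h1]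
  exact LinearMap.congr_fun ht x

lemma finite_of_addClosure [Module.Finite R M] {X : ModuleCat.{u} R} (hX : addClosure R M X) :
    Module.Finite R X := by
  obtain ⟨r, s, p, h⟩ := hX
  exact Module.Finite.of_surjective p fun x => ⟨s x, LinearMap.congr_fun h x⟩

end AddClosure

/-! ### Approximations by `add M` -/

section Approximation
variable (k : Type v) {R : Type u} [Field k] [Ring R] [Algebra k R] [Module.Finite k R]

/-- Multiplication by a scalar of the base field. -/
def scalarHom {k : Type v} (R : Type u) [Field k] [Ring R] [Algebra k R]
    (X : Type u) [AddCommGroup X] [Module R X] (c : k) : X →ₗ[R] X where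
  toFun x := algebraMap k R c • x
  map_add' := smul_add _
  map_smul' r x := by rw [← mul_smul, Algebra.commutes, mul_smul]; rfl

lemma exists_span_hom (M X : Type u) [AddCommGroup M] [Module R M] [Module.Finite R M]
    [AddCommGroup X] [Module R X] [Module.Finite R X] :
    ∃ (r : ℕ) (f : Fin r → M →ₗ[R] X), ∀ h : M →ₗ[R] X, ∃ c : Fin r → k,
      ∀ m, h m = ∑ b, algebraMap k R (c b) • f b m := by
  let _ : Module k M := Module.compHom M (algebraMap k R)
  let _ : Module k X := Module.compHom X (algebraMap k R)
  have : IsScalarTower k R M := IsScalarTower.of_algebraMap_smul fun _ _ => rfl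
  have : IsScalarTower k R X := IsScalarTower.of_algebraMap_smul fun _ _ => rfl
  have : SMulCommClass R k X := ⟨fun r c x => by
    change r • algebraMap k R c • x = algebraMap k R c • r • x
    rw [← mul_smul, ← Algebra.commutes, mul_smul]⟩
  have : Module.Finite k M := Module.Finite.trans R M
  have : Module.Finite k X := Module.Finite.trans R X
  have : Module.Finite k (M →ₗ[R] X) :=
    Module.Finite.of_injective (LinearMap.restrictScalarsₗ k R M X k)
      (LinearMap.restrictScalars_injective k)
  obtain ⟨r, f, hf⟩ := Module.Finite.exists_fin (R := k) (M := M →ₗ[R] X)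
  refine ⟨r, f, fun h => ?_⟩
  obtain ⟨c, hc⟩ := (Submodule.mem_span_range_iff_exists_fun k).1
    (hf ▸ Submodule.mem_top : h ∈ Submodule.span k (Set.range f))
  refine ⟨c, fun m => ?_⟩
  rw [← hc, LinearMap.sum_apply]
  rfl

variable {M : ModuleCat.{u} R} [Module.Finite R M]

-- Evaluation on a finite family spanning Hom(`M`, `X`) over `k` is a right approximation; the
-- coefficients of a given map define the factorisation.
include k in
lemma addClosure_contravariantlyFinite (X : ModuleCat.{u} R) [Module.Finite R X] :
    ∃ (V : ModuleCat.{u} R) (f : V ⟶ X), addClosure R M V ∧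
      ∀ (W : ModuleCat.{u} R) (g : W ⟶ X), addClosure R M W → ∃ h : W ⟶ V, h ≫ f = g := by
  obtain ⟨r, f, hf⟩ := exists_span_hom k (R := R) M X
  refine ⟨ModuleCat.of R (Fin r → M), ModuleCat.ofHom (∑ b, f b ∘ₗ LinearMap.proj b),
    ⟨r, LinearMap.id, LinearMap.id, rfl⟩, ?_⟩
  rintro W g ⟨m, s, p, hps⟩
  choose c hc using fun a : Fin m => hf (g.hom ∘ₗ p ∘ₗ LinearMap.single R (fun _ => (M : Type u)) a)
  refine ⟨ModuleCat.ofHom ((LinearMap.pi fun b => ∑ a, scalarHom R M (c a b) ∘ₗ LinearMap.proj a) ∘ₗ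
    s), ?_⟩
  ext w
  have h1 : w = p (s w) := (LinearMap.congr_fun hps w).symm
  conv_rhs => rw [h1, ← LinearMap.sum_single_apply (fun _ : Fin m => (M : Type u)) (s w)]
  simp only [ModuleCat.hom_comp, ModuleCat.hom_ofHom, LinearMap.comp_apply, LinearMap.sum_apply,
    map_sum, LinearMap.proj_apply, LinearMap.pi_apply, scalarHom]
  rw [Finset.sum_comm]
  refine Finset.sum_congr rfl fun a _ => ?_
  have := hc a (s w a)
  simp only [LinearMap.comp_apply, LinearMap.coe_single] at this
  rw [this]
  refine Finset.sum_congr rfl fun b _ => ?_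
  simp

include k in
lemma addClosure_covariantlyFinite (X : ModuleCat.{u} R) [Module.Finite R X] :
    ∃ (V : ModuleCat.{u} R) (f : X ⟶ V), addClosure R M V ∧
      ∀ (W : ModuleCat.{u} R) (g : X ⟶ W), addClosure R M W → ∃ h : V ⟶ W, f ≫ h = g := by
  obtain ⟨r, f, hf⟩ := exists_span_hom k (R := R) X M
  refine ⟨ModuleCat.of R (Fin r → M), ModuleCat.ofHom (LinearMap.pi f),
    ⟨r, LinearMap.id, LinearMap.id, rfl⟩, ?_⟩
  rintro W g ⟨m, s, p, hps⟩
  choose c hc using fun a : Fin m => hf (LinearMap.proj a ∘ₗ s ∘ₗ g.hom)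
  refine ⟨ModuleCat.ofHom (p ∘ₗ LinearMap.pi fun a => ∑ b, scalarHom R M (c a b) ∘ₗ
    LinearMap.proj b), ?_⟩
  ext x
  have h1 : g.hom x = p (s (g.hom x)) := (LinearMap.congr_fun hps _).symm
  rw [h1]
  simp only [ModuleCat.hom_comp, ModuleCat.hom_ofHom, LinearMap.comp_apply]
  congr 1
  ext a
  have := hc a x
  simp only [LinearMap.comp_apply, LinearMap.proj_apply] at this
  rw [this]
  simp [scalarHom]

end Approximation

/-! ### Cluster tilting modules -/

open Abelian

section
variable {R : Type u} [Ring R]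

lemma subsingleton_ext_of_isCompl_right {X : ModuleCat.{u} R} {N : Type u} [AddCommGroup N]
    [Module R N] {K L : Submodule R N} (h : IsCompl K L) {r : ℕ}
    (hK : Subsingleton (Ext X (ModuleCat.of R K) r))
    (hL : Subsingleton (Ext X (ModuleCat.of R L) r)) :
    Subsingleton (Ext X (ModuleCat.of R N) r) := by
  refine subsingleton_ext_of_sum_right (ι := Bool)
    (fun b => match b with | true => ModuleCat.of R K | false => ModuleCat.of R L)
    (fun b => match b with
      | true => ModuleCat.ofHom (K.projectionOnto L h)
      | false => ModuleCat.ofHom (L.projectionOnto K h.symm))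
    (fun b => match b with
      | true => ModuleCat.ofHom K.subtype
      | false => ModuleCat.ofHom L.subtype) ?_ (fun b => match b with | true => hK | false => hL)
  ext x
  simp only [Fintype.sum_bool, ModuleCat.hom_add, ModuleCat.hom_comp, ModuleCat.hom_ofHom,
    LinearMap.add_apply, LinearMap.comp_apply, ModuleCat.hom_id, LinearMap.id_apply,
    Submodule.subtype_apply]
  exact Submodule.projection_add_projection_eq_self h x

lemma subsingleton_ext_of_isCompl_left {Y : ModuleCat.{u} R} {N : Type u} [AddCommGroup N]
    [Module R N] {K L : Submodule R N} (h : IsCompl K L) {r : ℕ}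
    (hK : Subsingleton (Ext (ModuleCat.of R K) Y r))
    (hL : Subsingleton (Ext (ModuleCat.of R L) Y r)) :
    Subsingleton (Ext (ModuleCat.of R N) Y r) := by
  refine subsingleton_ext_of_sum_left (ι := Bool)
    (fun b => match b with | true => ModuleCat.of R K | false => ModuleCat.of R L)
    (fun b => match b with
      | true => ModuleCat.ofHom (K.projectionOnto L h)
      | false => ModuleCat.ofHom (L.projectionOnto K h.symm))
    (fun b => match b with
      | true => ModuleCat.ofHom K.subtype
      | false => ModuleCat.ofHom L.subtype) ?_ (fun b => match b with | true => hK | false => hL)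
  ext x
  simp only [Fintype.sum_bool, ModuleCat.hom_add, ModuleCat.hom_comp, ModuleCat.hom_ofHom,
    LinearMap.add_apply, LinearMap.comp_apply, ModuleCat.hom_id, LinearMap.id_apply,
    Submodule.subtype_apply]
  exact Submodule.projection_add_projection_eq_self h x

lemma subsingleton_ext_of_subsingleton_right {X : ModuleCat.{u} R} {N : Type u} [AddCommGroup N]
    [Module R N] (h : Subsingleton N) {r : ℕ} : Subsingleton (Ext X (ModuleCat.of R N) r) :=
  subsingleton_ext_of_sum_right (ι := Empty) (fun _ => X) (fun b => b.elim) (fun b => b.elim)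
    (by ext x; exact Subsingleton.elim (α := N) _ _) fun b => b.elim

lemma subsingleton_ext_of_subsingleton_left {Y : ModuleCat.{u} R} {N : Type u} [AddCommGroup N]
    [Module R N] (h : Subsingleton N) {r : ℕ} : Subsingleton (Ext (ModuleCat.of R N) Y r) :=
  subsingleton_ext_of_sum_left (ι := Empty) (fun _ => Y) (fun b => b.elim) (fun b => b.elim)
    (by ext x; exact Subsingleton.elim (α := N) _ _) fun b => b.elim

lemma subsingleton_ext_of_projective {X Y : ModuleCat.{u} R} [Module.Projective R X] {r : ℕ}
    (hr : 1 ≤ r) : Subsingleton (Ext X Y r) := by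
  obtain ⟨r, rfl⟩ := Nat.exists_eq_add_of_le' hr
  have : Projective X := (IsProjective.iff_projective X).1 inferInstance
  exact Ext.subsingleton_of_projective X Y r

lemma subsingleton_ext_of_injective {X Y : ModuleCat.{u} R} (h : Module.Injective R Y) {r : ℕ}
    (hr : 1 ≤ r) : Subsingleton (Ext X Y r) := by
  obtain ⟨r, rfl⟩ := Nat.exists_eq_add_of_le' hr
  have : Injective Y := Module.injective_object_of_injective_module R Y
  exact subsingleton_of_forall_eq 0 fun e => Ext.eq_zero_of_injective e

end

/-- Maps to a module of full length are stably zero: the inequality in `StHom` would force `c >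
x.2`. -/
lemma not_stHom_of_length {a n : ℕ} {x y : ZMod n × ℕ} (hy : y.2 = a * n + 1) :
    ¬ StHom a x y := by
  rintro ⟨c, h1, h2, h3, h4, -⟩
  omega

namespace IsNakayamaSystem
variable {R : Type u} [Ring R] [IsArtinianRing R] {a n : ℕ} {P : ZMod n → ModuleCat.{u} R}
  (hP : IsNakayamaSystem n (a * n + 1) P) (hR : IsSymmNakayamaRing R) (han : 1 ≤ a * n)
  {M : ModuleCat.{u} R}

/-- The types of the non-projective indecomposable summands of `M`. -/
def summandTypes (a : ℕ) {n : ℕ} (P : ZMod n → ModuleCat.{u} R) (M : ModuleCat.{u} R) :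
    Set (ZMod n × ℕ) :=
  {x | (1 ≤ x.2 ∧ x.2 ≤ a * n) ∧ ∃ X : ModuleCat.{u} R, IsOfType P x X ∧ addClosure R M X}

include hP hR in
lemma mem_summandTypes_iff {x : ZMod n × ℕ} {X : ModuleCat.{u} R} (hX : IsOfType P x X)
    (hx : x.2 ≤ a * n) : x ∈ summandTypes a P M ↔ addClosure R M X := by
  constructor
  · rintro ⟨-, X', hX', hadd⟩
    obtain ⟨e⟩ := hP.equiv_of_type hR hX' hX
    exact addClosure_of_equiv hadd e
  · exact fun h => ⟨⟨hX.pos, hx⟩, X, hX, h⟩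

include hP hR han

/-- Ext vanishing can be tested on indecomposable summands, and those of full length contribute
nothing. -/
lemma forall_ext_right_iff [Module.Finite R M] {x : ZMod n × ℕ} {X : ModuleCat.{u} R}
    (hX : IsOfType P x X) (hx : x.2 ≤ a * n) {r : ℕ} (hr : 1 ≤ r) :
    (∀ Y : ModuleCat.{u} R, addClosure R M Y → Subsingleton (Ext X Y r)) ↔
      ∀ y ∈ summandTypes a P M, ¬ StHom a ((syz a)^[r] x) y := by
  constructor
  · rintro h y ⟨-, Y, hY, hadd⟩
    exact (hP.subsingleton_ext_iff hR han hX hY hx hr).1 (h Y hadd)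
  · intro h Y hY
    have := finite_of_addClosure hY
    refine decomposition_induction (R := R) (motive := fun N _ _ =>
      addClosure R M (ModuleCat.of R N) → Subsingleton (Ext X (ModuleCat.of R N) r))
      ?_ ?_ ?_ Y hY
    · exact fun N _ _ hN _ => subsingleton_ext_of_subsingleton_right hN
    · intro N _ _ hfin hN hadd
      obtain ⟨y, hy⟩ := hP.exists_type_of_indecomposable hR hN
      refine (hP.subsingleton_ext_iff hR han hX hy hx hr).2 ?_
      obtain hlt | heq := (hP.le_of_type hy).lt_or_eq
      · exact h y ⟨⟨hy.pos, by omega⟩, ModuleCat.of R N, hy, hadd⟩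
      · exact not_stHom_of_length heq
    · intro N _ _ hfin K L hKL hK hL hadd
      exact subsingleton_ext_of_isCompl_right hKL (hK (addClosure_submodule hadd hKL))
        (hL (addClosure_submodule hadd hKL.symm))

lemma forall_ext_left_iff [Module.Finite R M] {x : ZMod n × ℕ} {X : ModuleCat.{u} R}
    (hX : IsOfType P x X) {r : ℕ} (hr : 1 ≤ r) :
    (∀ Y : ModuleCat.{u} R, addClosure R M Y → Subsingleton (Ext Y X r)) ↔
      ∀ y ∈ summandTypes a P M, ¬ StHom a ((syz a)^[r] y) x := by
  constructor
  · rintro h y ⟨hyv, Y, hY, hadd⟩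
    exact (hP.subsingleton_ext_iff hR han hY hX hyv.2 hr).1 (h Y hadd)
  · intro h Y hY
    have := finite_of_addClosure hY
    refine decomposition_induction (R := R) (motive := fun N _ _ =>
      addClosure R M (ModuleCat.of R N) → Subsingleton (Ext (ModuleCat.of R N) X r))
      ?_ ?_ ?_ Y hY
    · exact fun N _ _ hN _ => subsingleton_ext_of_subsingleton_left hN
    · intro N _ _ hfin hN hadd
      obtain ⟨y, hy⟩ := hP.exists_type_of_indecomposable hR hN
      obtain hlt | heq := (hP.le_of_type hy).lt_or_eq
      · exact (hP.subsingleton_ext_iff hR han hy hX (by omega) hr).2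
          (h y ⟨⟨hy.pos, by omega⟩, ModuleCat.of R N, hy, hadd⟩)
      · have := hP.projective_of_type hy heq
        exact subsingleton_ext_of_projective (X := ModuleCat.of R N) hr
    · intro N _ _ hfin K L hKL hK hL hadd
      exact subsingleton_ext_of_isCompl_left hKL (hK (addClosure_submodule hadd hKL))
        (hL (addClosure_submodule hadd hKL.symm))

theorem isCombCT_summandTypes [Module.Finite R M] {d : ℕ}
    (h : IsClusterTilting R d (addClosure R M)) : IsCombCT a n d (summandTypes a P M) := by
  refine ⟨fun x hx => hx.1, fun x hx1 hx2 => ?_, fun x hx1 hx2 => ?_⟩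
  · obtain ⟨X, hX⟩ := hP.exists_isOfType hx1 (by omega)
    have := hP.finite_of_type hX
    rw [hP.mem_summandTypes_iff hR hX hx2, h.mem_iff_ext_left X this]
    constructor
    · intro h y hy r hr1 hr2
      exact (hP.forall_ext_right_iff hR han hX hx2 hr1).1 (fun Y hY => h Y hY r hr1 hr2) y hy
    · intro h Y hY r hr1 hr2
      exact (hP.forall_ext_right_iff hR han hX hx2 hr1).2 (fun y hy => h y hy r hr1 hr2) Y hY
  · obtain ⟨X, hX⟩ := hP.exists_isOfType hx1 (by omega)
    have := hP.finite_of_type hX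
    rw [hP.mem_summandTypes_iff hR hX hx2, h.mem_iff_ext_right X this]
    constructor
    · intro h y hy r hr1 hr2
      exact (hP.forall_ext_left_iff hR han hX hr1).1 (fun Y hY => h Y hY r hr1 hr2) y hy
    · intro h Y hY r hr1 hr2
      exact (hP.forall_ext_left_iff hR han hX hr1).2 (fun y hy => h y hy r hr1 hr2) Y hY

theorem exists_isClusterTilting (k : Type v) [Field k] [Algebra k R] [Module.Finite k R] {d : ℕ}
    {U : Finset (ZMod n × ℕ)} (hU : IsCombCT a n d (U : Set (ZMod n × ℕ))) :
    ∃ M : ModuleCat.{u} R, Module.Finite R M ∧ IsClusterTilting R d (addClosure R M) := by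
  choose X hX using fun x : U => hP.exists_isOfType (hU.valid x x.2).1
    ((hU.valid x x.2).2.trans (Nat.le_succ _))
  -- The index `none` carries the regular module, which supplies all projectives.
  let Z : Option U → ModuleCat.{u} R := fun o => o.elim (ModuleCat.of R R) X
  have hZfin : ∀ o, Module.Finite R (Z o) := by
    rintro (_ | x)
    · exact inferInstanceAs (Module.Finite R R)
    · exact hP.finite_of_type (hX x)
  let M : ModuleCat.{u} R := ModuleCat.of R (∀ o, Z o)
  have hM : Module.Finite R M := inferInstanceAs (Module.Finite R (∀ o, Z o))
  have hZadd : ∀ o, addClosure R M (Z o) := fun o =>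
    addClosure_of_summand (LinearMap.single R (fun o => (Z o : Type u)) o) (LinearMap.proj o)
      (LinearMap.ext fun x => Pi.single_eq_same (M := fun o => (Z o : Type u)) o x)
  have hproj : ∀ Y : ModuleCat.{u} R, Module.Finite R Y → Module.Projective R Y →
      addClosure R M Y := fun Y _ _ =>
    addClosure_projective (M := M) (LinearMap.single R (fun o => (Z o : Type u)) none)
      (LinearMap.proj none : (∀ o, Z o) →ₗ[R] Z none)
      (LinearMap.ext fun x => Pi.single_eq_same (M := fun o => (Z o : Type u)) none x)
  have hZZ : ∀ o o' r, 1 ≤ r → r < d → Subsingleton (Ext (Z o) (Z o') r) := by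
    rintro (_ | x) (_ | y) r hr1 hr2
    · exact subsingleton_ext_of_injective hR.injective hr1
    · have : Module.Projective R (Z none) := inferInstanceAs (Module.Projective R R)
      exact subsingleton_ext_of_projective hr1
    · exact subsingleton_ext_of_injective hR.injective hr1
    · exact (hP.subsingleton_ext_iff hR han (hX x) (hX y) (hU.valid x x.2).2 hr1).2
        (hU.not_stHom x.2 y.2 hr1 hr2)
  have hsum : ∑ o, ModuleCat.ofHom (LinearMap.proj o : (∀ o, Z o) →ₗ[R] Z o) ≫
      ModuleCat.ofHom (LinearMap.single R (fun o => (Z o : Type u)) o) = 𝟙 M := by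
    refine ModuleCat.hom_ext (LinearMap.ext fun x => ?_)
    rw [ModuleCat.hom_sum, LinearMap.sum_apply]
    exact LinearMap.sum_single_apply (fun o => (Z o : Type u)) x
  have hMM : ∀ r, 1 ≤ r → r < d → Subsingleton (Ext M M r) := fun r hr1 hr2 =>
    subsingleton_ext_of_sum_left Z _ _ hsum fun o =>
      subsingleton_ext_of_sum_right Z _ _ hsum fun o' => hZZ o o' r hr1 hr2
  have hrigid : ∀ Y Y' : ModuleCat.{u} R, addClosure R M Y → addClosure R M Y' → ∀ r, 1 ≤ r →
      r < d → Subsingleton (Ext Y Y' r) := fun Y Y' hY hY' r hr1 hr2 =>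
    subsingleton_ext_of_addClosure_left hY
      (subsingleton_ext_of_addClosure_right hY' (hMM r hr1 hr2))
  have hmem : ∀ (x : ZMod n × ℕ) (Y : ModuleCat.{u} R), x ∈ U → IsOfType P x Y →
      addClosure R M Y := by
    intro x Y hx hY
    obtain ⟨e⟩ := hP.equiv_of_type hR (hX ⟨x, hx⟩) hY
    exact addClosure_of_equiv (hZadd (some ⟨x, hx⟩)) e
  refine ⟨M, hM, fun Y hY => finite_of_addClosure hY,
    fun Y _ => addClosure_contravariantlyFinite k Y, fun Y _ => addClosure_covariantlyFinite k Y,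
    fun Y hYfin => ⟨fun hY Y' hY' r hr1 hr2 => hrigid Y Y' hY hY' r hr1 hr2, fun h => ?_⟩,
    fun Y hYfin => ⟨fun hY Y' hY' r hr1 hr2 => hrigid Y' Y hY' hY r hr1 hr2, fun h => ?_⟩⟩
  -- The Ext conditions pass to direct summands, so an indecomposable suffices: one of full length
  -- is projective, any other is recognised by its type.
  · refine decomposition_induction (R := R) (motive := fun N _ _ =>
      (∀ Y', addClosure R M Y' → ∀ r, 1 ≤ r → r < d →
        Subsingleton (Ext (ModuleCat.of R N) Y' r)) → addClosure R M (ModuleCat.of R N))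
      ?_ ?_ ?_ Y h
    · intro N _ _ hN _
      have : Module.Projective R N := Module.Projective.of_free
      exact hproj (ModuleCat.of R N) (inferInstanceAs (Module.Finite R N)) this
    · intro N _ _ hfin hN hext
      obtain ⟨x, hx⟩ := hP.exists_type_of_indecomposable hR hN
      obtain hlt | heq := (hP.le_of_type hx).lt_or_eq
      · refine hmem x (ModuleCat.of R N) ?_ hx
        rw [← Finset.mem_coe, hU.mem_left x hx.pos (by omega)]
        intro y hy r hr1 hr2
        exact (hP.subsingleton_ext_iff hR han hx (hX ⟨y, hy⟩) (by omega) hr1).1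
          (hext _ (hZadd (some ⟨y, hy⟩)) r hr1 hr2)
      · exact hproj (ModuleCat.of R N) hfin (hP.projective_of_type hx heq)
    · intro N _ _ hfin K L hKL hK hL hext
      refine addClosure_of_isCompl hKL (hK fun Y' hY' r hr1 hr2 => ?_)
        (hL fun Y' hY' r hr1 hr2 => ?_)
      · exact subsingleton_ext_of_retract_left (X := ModuleCat.of R K) (X' := ModuleCat.of R N)
          K.subtype (K.projectionOnto L hKL) (by ext x; simp) (hext Y' hY' r hr1 hr2)
      · exact subsingleton_ext_of_retract_left (X := ModuleCat.of R L) (X' := ModuleCat.of R N)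
          L.subtype (L.projectionOnto K hKL.symm) (by ext x; simp) (hext Y' hY' r hr1 hr2)
  · refine decomposition_induction (R := R) (motive := fun N _ _ =>
      (∀ Y', addClosure R M Y' → ∀ r, 1 ≤ r → r < d →
        Subsingleton (Ext Y' (ModuleCat.of R N) r)) → addClosure R M (ModuleCat.of R N))
      ?_ ?_ ?_ Y h
    · intro N _ _ hN _
      have : Module.Projective R N := Module.Projective.of_free
      exact hproj (ModuleCat.of R N) (inferInstanceAs (Module.Finite R N)) this
    · intro N _ _ hfin hN hext
      obtain ⟨x, hx⟩ := hP.exists_type_of_indecomposable hR hN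
      obtain hlt | heq := (hP.le_of_type hx).lt_or_eq
      · refine hmem x (ModuleCat.of R N) ?_ hx
        rw [← Finset.mem_coe, hU.mem_right x hx.pos (by omega)]
        intro y hy r hr1 hr2
        exact (hP.subsingleton_ext_iff hR han (hX ⟨y, hy⟩) hx (hU.valid y hy).2 hr1).1
          (hext _ (hZadd (some ⟨y, hy⟩)) r hr1 hr2)
      · exact hproj (ModuleCat.of R N) hfin (hP.projective_of_type hx heq)
    · intro N _ _ hfin K L hKL hK hL hext
      refine addClosure_of_isCompl hKL (hK fun Y' hY' r hr1 hr2 => ?_)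
        (hL fun Y' hY' r hr1 hr2 => ?_)
      · exact subsingleton_ext_of_retract_right (Y := ModuleCat.of R K) (Y' := ModuleCat.of R N)
          K.subtype (K.projectionOnto L hKL) (by ext x; simp) (hext Y' hY' r hr1 hr2)
      · exact subsingleton_ext_of_retract_right (Y := ModuleCat.of R L) (Y' := ModuleCat.of R N)
          L.subtype (L.projectionOnto K hKL.symm) (by ext x; simp) (hext Y' hY' r hr1 hr2)

end IsNakayamaSystem
end NakayamaCT

theorem theorem1p2 (k : Type v) (B : Type u) [Field k] [Ring B] [Algebra k B]
    [FiniteDimensional k B]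
    (hind : NakayamaCT.IsRingIndecomposable B)
    (hsymm : NakayamaCT.IsSymmetricAlgebra k B)
    (hnak : NakayamaCT.IsNakayama B)
    (a n d : ℕ) (ha : 1 ≤ a) (hd : 2 ≤ d)
    (hn : NakayamaCT.HasNumSimples B n)
    (hl : NakayamaCT.HasLoewyLength B (a * n + 1)) :
    NakayamaCT.IsRepresentationFinite d B ↔
      (a, n, d) ∈ ({p : ℕ × ℕ × ℕ | ∃ t : ℕ, 2 ≤ t ∧ p = (1, t, 2 * t - 1)} ∪
        {(1, 3, 2), (1, 6, 2), (2, 3, 2)} : Set (ℕ × ℕ × ℕ)) := by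
  have : Module.Finite k Bᵐᵒᵖ := Module.Finite.equiv (MulOpposite.opLinearEquiv k : B ≃ₗ[k] Bᵐᵒᵖ)
  have : IsArtinianRing B := IsArtinianRing.of_finite k B
  have : IsArtinianRing Bᵐᵒᵖ := IsArtinianRing.of_finite k Bᵐᵒᵖ
  have hR := NakayamaCT.isSymmNakayamaRing hsymm hnak
  have hind' := NakayamaCT.isRingIndecomposable_mulOpposite hind
  have hLL := NakayamaCT.hasLoewyLength_mulOpposite (IsSemiprimaryRing.isNilpotent)
    (IsSemiprimaryRing.isNilpotent) hl
  obtain ⟨S, h1, h2, h3⟩ := hn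
  obtain ⟨Q, hQ⟩ := hR.exists_isProjSystem h1 h2 h3
  -- A non-zero ring has a simple module, so the index set of simples is non-empty.
  have hn : 1 ≤ n := by
    have := hind'.1
    obtain ⟨K, hK⟩ := NakayamaCT.exists_simple_quotient (R := Bᵐᵒᵖ) Bᵐᵒᵖ
    obtain ⟨i, -⟩ := h3 (ModuleCat.of Bᵐᵒᵖ (Bᵐᵒᵖ ⧸ K)) hK
    have := i.2
    omega
  have han : 1 ≤ a * n := Nat.mul_pos ha hn
  obtain ⟨P, hP⟩ := hR.exists_isNakayamaSystem hind' hn (by omega) hQ hLL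
  constructor
  · rintro ⟨M, hM, hCT⟩
    exact (hP.isCombCT_summandTypes hR han hCT).mem_list hd hn ha
  · intro h
    obtain ⟨U, hU⟩ := NakayamaCT.exists_isCombCT h
    exact hP.exists_isClusterTilting hR han k hU
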